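/- **Setting.** Let $\mathcal X$ be a measurable space with a $\sigma$-finite reference measure $dx$ (e.g. a subset of $\mathbb R^d$ with Lebesgue measure). One observes i.i.d. pairs $(X_i,Y_i)_{i=1}^n$ with $$Y_i=\mu(X_i)+\sigma(X_i)\epsilon_i ,$$ where $X_i$ and $\epsilon_i$ are independent, $\epsilon_i$ has a known density $f$ with respect to Lebesgue measure on $\mathbb R$, and $X_i$ has a density $h\in\mathcal H$ with respect to $dx$. The regression function $\mu$ belongs to a class $\mathcal U$ of measurable functions with $\sup_{\mu\in\mathcal U}\|\mu\|_\infty<\infty$; the scale function $\sigma$ belongs to a nonempty class $\Sigma$ of measurable functions with $\overline\sigma^{-1}\le\sigma(x)\le\overline\sigma$ for all $x\in\mathcal X$ and all $\sigma\in\Sigma$, for a fixed $\overline\sigma>1$. Write $\|u-v\|_{2,h}^2=\int(u-v)^2h\,dx$. For a class $V$ of functions and $\varepsilon>0$, let $M_h(\varepsilon;V)\in[0,\infty]$ be its packing entropy, i.e. the logarithm of the supremum of the cardinalities of finite $N\subset V$ with $\|u-v\|_{2,h}>\varepsilon$ for all distinct $u,v\in N$. Let $f_{\eta,\sigma}(y)=\frac1\sigma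 f\big(\frac{y-\eta}{\sigma}\big)$ and let $D(q_1\|q_2)=\int q_1\log\frac{q_1}{q_2}$ be the Kullback–Leibler divergence. **Assumptions.** $D(f_{0,1}\|f_{\eta,\sigma})$ is finite and continuous in $(\eta,\sigma)\in\mathbb R\times(0,\infty)$, and: 1. $D(f_{0,1}\|f_{\eta,\sigma})=O(\eta^2+(1-\sigma)^2)$ for $(\eta,\sigma)$ near $(0,1)$. 2. The family $\{f_{\eta,\sigma}\}$ is Hellinger differentiable at $(0,1)$ with linearly independent derivative components: there are $\dot\xi_1,\dot\xi_2\in L_2(\mathbb R)$, linearly independent in $L_2(\mathbb R)$, such that $\big\|\sqrt{f_{\eta,\sigma}}-\sqrt{f_{0,1}}-\eta\dot\xi_1-(\sigma-1)\dot\xi_2\big\|_{L_2(\mathbb R)}=o\big(\sqrt{\eta^2+(\sigma-1)^2}\big)$ as $(\eta,\sigma)\to(0,1)$. 3. There are $h_0\in\mathcal H$ and $C<\infty$ with $h(x)\le C\,h_0(x)$ for all $x\in\mathcal X$ and all $h\in\mathcal H$. 4. $M_{h_0}(\varepsilon;\mathcal U)$ is of order $M(\varepsilon)$ as $\varepsilon\to0^+$,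 i.e. $M_{h_0}(\varepsilon;\mathcal U)\asymp M(\varepsilon)$ (in particular it is finite), where $M\ge 0$ is rich ($\liminf_{\varepsilon\to0^+}M(\alpha\varepsilon)/M(\varepsilon)>1$ for some $0<\alpha<1$) and order regular ($M(c\varepsilon)\asymp M(\varepsilon)$ as $\varepsilon\to0^+$ for every $c>0$). Moreover $M_{h_0}(\varepsilon;\Sigma)=O(M(\varepsilon))$ as $\varepsilon\to0^+$. **Conclusion.** Let $\varepsilon_n>0$ with $\varepsilon_n\to0$ be determined by $M(\varepsilon_n)=n\varepsilon_n^2$ for all large $n$. Then, as $n\to\infty$, $$\inf_{\hat\mu}\ \sup_{\mu\in\mathcal U,\,\sigma\in\Sigma,\,h\in\mathcal H}\mathbb E\|\mu-\hat\mu\|_{2,h}^2\asymp\varepsilon_n^2 ,$$ where the infimum is over all (measurable) estimators $\hat\mu$ based on the $n$ observations; that is, the ratio of the two sides is bounded between two positive constants for all large $n$. -/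

import Mathlib

open MeasureTheory Filter Topology

noncomputable section

namespace LocScale

/-- `p` is a probability density with respect to `ν`. -/
structure IsDensity {α : Type*} [MeasurableSpace α] (ν : Measure α) (p : α → ℝ) : Prop where
  measurable : Measurable p
  nonneg : ∀ x, 0 ≤ p x
  lintegral_eq_one : ∫⁻ x, ENNReal.ofReal (p x) ∂ν = 1

/-- The measure with density `p` with respect to `ν`. -/
def densityMeasure {α : Type*} [MeasurableSpace α] (ν : Measure α) (p : α → ℝ) : Measure α :=
  ν.withDensity fun x => ENNReal.ofReal (p x)

/-- The member `f_{η,σ}(y) = σ⁻¹ f((y - η)/σ)` of the location-scale family generated by `f`. -/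
def lsDensity (f : ℝ → ℝ) (η σ : ℝ) (y : ℝ) : ℝ :=
  1 / σ * f ((y - η) / σ)

/-- The Kullback-Leibler divergence `D(f_{0,1} ‖ f_{η,σ})`, as a function of `(η, σ)`. -/
def lsKL (f : ℝ → ℝ) (θ : ℝ × ℝ) : ENNReal :=
  InformationTheory.klDiv (densityMeasure volume (lsDensity f 0 1))
    (densityMeasure volume (lsDensity f θ.1 θ.2))

/-- `D(f_{0,1} ‖ f_{η,σ})` is finite and continuous in `(η, σ) ∈ ℝ × (0, ∞)`. -/
def KLFiniteContinuous (f : ℝ → ℝ) : Prop :=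
  (∀ θ : ℝ × ℝ, 0 < θ.2 → lsKL f θ < ⊤) ∧ ContinuousOn (lsKL f) {θ : ℝ × ℝ | 0 < θ.2}

/-- `D(f_{0,1} ‖ f_{η,σ}) = O(η² + (1 - σ)²)` for `(η, σ)` near `(0, 1)`. -/
def KLLocallyQuadratic (f : ℝ → ℝ) : Prop :=
  ∃ K : ℝ, ∀ᶠ θ : ℝ × ℝ in 𝓝 (0, 1), lsKL f θ ≤ ENNReal.ofReal (K * (θ.1 ^ 2 + (1 - θ.2) ^ 2))

/-- The pair `(ξ₁, ξ₂)` of square integrable functions is the Hellinger derivative of the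
location-scale family at `(0, 1)`: the `L²` norm of
`√f_{η,σ} - √f_{0,1} - η ξ₁ - (σ - 1) ξ₂` is `o(|(η, σ) - (0, 1)|)`. -/
def HasHellingerDeriv (f ξ₁ ξ₂ : ℝ → ℝ) : Prop :=
  MemLp ξ₁ 2 volume ∧ MemLp ξ₂ 2 volume ∧
  (fun θ : ℝ × ℝ => (eLpNorm (fun y => √(lsDensity f θ.1 θ.2 y) - √(lsDensity f 0 1 y)
      - (θ.1 * ξ₁ y + (θ.2 - 1) * ξ₂ y)) 2 volume).toReal)
    =o[𝓝 (0, 1)] fun θ : ℝ × ℝ => √(θ.1 ^ 2 + (θ.2 - 1) ^ 2)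

/-- The location-scale family is Hellinger differentiable at `(0, 1)` and the two components of
the derivative are linearly independent (as elements of `L²`). -/
def HellingerNondegenerate (f : ℝ → ℝ) : Prop :=
  ∃ ξ₁ ξ₂ : ℝ → ℝ, HasHellingerDeriv f ξ₁ ξ₂ ∧
    ∀ a b : ℝ, (∀ᵐ y ∂volume, a * ξ₁ y + b * ξ₂ y = 0) → a = 0 ∧ b = 0

/-- The squared `L₂(h)` distance `‖u - v‖²_{2,h} = ∫ (u - v)² h dν`. -/
def sqDist {𝒳 : Type*} [MeasurableSpace 𝒳] (ν : Measure 𝒳) (h u v : 𝒳 → ℝ) : ENNReal :=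
  ∫⁻ x, ENNReal.ofReal ((u x - v x) ^ 2 * h x) ∂ν

/-- `N` is an `ε`-packing set in `V` for the `L₂(h)` distance: distinct members are at distance
greater than `ε` (the definition is used for `ε > 0`). -/
def IsPacking {𝒳 : Type*} [MeasurableSpace 𝒳] (ν : Measure 𝒳) (h : 𝒳 → ℝ) (V : Set (𝒳 → ℝ))
    (ε : ℝ) (N : Finset (𝒳 → ℝ)) : Prop :=
  (∀ u ∈ N, u ∈ V) ∧ ∀ u ∈ N, ∀ v ∈ N, u ≠ v → ENNReal.ofReal (ε ^ 2) < sqDist ν h u v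

/-- The packing `ε`-entropy of `V` in the `L₂(h)` distance: the logarithm of the maximal cardinality
of an `ε`-packing set, equal to `⊤` if these cardinalities are unbounded. -/
def packingEntropy {𝒳 : Type*} [MeasurableSpace 𝒳] (ν : Measure 𝒳) (h : 𝒳 → ℝ)
    (V : Set (𝒳 → ℝ)) (ε : ℝ) : ENNReal :=
  ⨆ (N : Finset (𝒳 → ℝ)) (_ : IsPacking ν h V ε N), ENNReal.ofReal (Real.log N.card)

/-- `M` is an order of the entropy function `K`: `M(ε) ≍ K(ε)` as `ε → 0+`. -/
def IsEntropyOrder (M : ℝ → ℝ) (K : ℝ → ENNReal) : Prop :=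
  ∃ a b : ℝ, 0 < a ∧ 0 < b ∧ ∀ᶠ ε in 𝓝[>] (0 : ℝ),
    0 ≤ M ε ∧ ENNReal.ofReal (a * M ε) ≤ K ε ∧ K ε ≤ ENNReal.ofReal (b * M ε)

/-- Richness: `liminf_{ε → 0+} M(αε)/M(ε) > 1` for some `0 < α < 1`. -/
def Rich (M : ℝ → ℝ) : Prop :=
  ∃ α : ℝ, 0 < α ∧ α < 1 ∧
    1 < liminf (fun ε : ℝ => ((M (α * ε) / M ε : ℝ) : EReal)) (𝓝[>] (0 : ℝ))

/-- Order regularity: `M(cε) ≍ M(ε)` as `ε → 0+`, for every `c > 0`. -/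
def OrderRegular (M : ℝ → ℝ) : Prop :=
  ∀ c : ℝ, 0 < c → (fun ε : ℝ => M (c * ε)) =Θ[𝓝[>] (0 : ℝ)] M

/-- The law of one observation `(X, Y)`, `Y = μ(X) + σ(X) e`, where `X` has density `h` with respect
to `ν`, `e` has Lebesgue density `f`, and `X`, `e` are independent. -/
def obsLaw {𝒳 : Type*} [MeasurableSpace 𝒳] (ν : Measure 𝒳) (f : ℝ → ℝ) (μ σ h : 𝒳 → ℝ) :
    Measure (𝒳 × ℝ) :=
  ((densityMeasure ν h).prod (densityMeasure volume f)).map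
    fun z => (z.1, μ z.1 + σ z.1 * z.2)

/-- The risk `𝔼 ‖μ - μ̂‖²_{2,h}` of an estimator based on `n` i.i.d. observations. -/
def risk {𝒳 : Type*} [MeasurableSpace 𝒳] (ν : Measure 𝒳) (f : ℝ → ℝ) {n : ℕ}
    (est : (Fin n → 𝒳 × ℝ) → 𝒳 → ℝ) (μ σ h : 𝒳 → ℝ) : ENNReal :=
  ∫⁻ z, sqDist ν h μ (est z) ∂(Measure.pi fun _ : Fin n => obsLaw ν f μ σ h)

/-- The minimax risk: the infimum is over all (jointly measurable) estimators, the supremum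
over `μ ∈ U`, `σ ∈ S`, `h ∈ H`. -/
def minimaxRisk {𝒳 : Type*} [MeasurableSpace 𝒳] (ν : Measure 𝒳) (f : ℝ → ℝ)
    (U S H : Set (𝒳 → ℝ)) (n : ℕ) : ENNReal :=
  ⨅ (est : (Fin n → 𝒳 × ℝ) → 𝒳 → ℝ) (_ : Measurable (Function.uncurry est)),
    ⨆ μ ∈ U, ⨆ σ ∈ S, ⨆ h ∈ H, risk ν f est μ σ h

end LocScale

end

namespace LocScale

/-! ### Densities and their products -/

section Densities

variable {Ω : Type*} [MeasurableSpace Ω] {m : Measure Ω} {p q : Ω → ℝ}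

/-! Both bounds rest on one comparison. For parameters in the box allowed by the bounds on μ and σ,
the Kullback–Leibler divergence between two members of the location-scale family is at most a
constant times (η - η')² + (s - s')², and the squared Hellinger distance is at least a constant
times (η - η')². By affine equivariance only the relative parameter matters. It ranges over a
compact set, so it suffices to argue locally: at (0,1) by the quadratic divergence bound and the
nondegenerate Hellinger derivative, elsewhere by continuity of the divergence and by identifiability
(an atomless law is not invariant under a nontrivial affine map). Integrated over the design, these
become comparisons with L₂(h) distances.

Upper bound: take the maximum likelihood estimator over a product of ε_n-nets of U and S in L₂(h₀).
With the design law put into the reference measure, the likelihood does not involve h, so one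
estimator serves all of H, and h ≤ C h₀ keeps the nets good for every h.
`lintegral_maximumLikelihood_le` bounds its Hellinger risk by (log cardinality)/n plus the
approximation divergence. Both are O(ε_n²) because M(ε_n) = n ε_n².

Lower bound: fix σ and h₀. An ε_n-net of U has log-cardinality at most b M(ε_n), while richness
gives, at a radius α^l ε_n with l fixed, a packing whose log-cardinality is a large multiple of
M(ε_n). Replacing each packing point by its nearby net point costs a factor e^t with t of order n
ε_n² plus a small probability (`pi_le_exp_mul_add`). Under each net law, the disjoint events "the
estimator is close to u" have total probability at most 1. So the success probabilities average at
most 1/2 over the packing, and some u has risk of order (α^l ε_n)². -/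

theorem IsDensity.isProbabilityMeasure (hp : IsDensity m p) :
    IsProbabilityMeasure (densityMeasure m p) := by
  constructor
  rw [densityMeasure, withDensity_apply _ MeasurableSet.univ, Measure.restrict_univ,
    hp.lintegral_eq_one]

theorem IsDensity.integrable (hp : IsDensity m p) : Integrable p m := by
  refine ⟨hp.measurable.aestronglyMeasurable, ?_⟩
  rw [hasFiniteIntegral_iff_ofReal (Eventually.of_forall hp.nonneg), hp.lintegral_eq_one]
  exact ENNReal.one_lt_top

theorem IsDensity.integral_eq_one (hp : IsDensity m p) : ∫ x, p x ∂m = 1 := by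
  rw [integral_eq_lintegral_of_nonneg_ae (Eventually.of_forall hp.nonneg)
    hp.measurable.aestronglyMeasurable, hp.lintegral_eq_one, ENNReal.toReal_one]

theorem isDensity_of_integral (hpm : Measurable p) (hp0 : ∀ x, 0 ≤ p x) (hpi : Integrable p m)
    (h1 : ∫ x, p x ∂m = 1) : IsDensity m p :=
  ⟨hpm, hp0, by
    rw [← ofReal_integral_eq_lintegral_ofReal hpi (Eventually.of_forall hp0), h1,
      ENNReal.ofReal_one]⟩

theorem lintegral_densityMeasure (hp : Measurable p) {F : Ω → ENNReal} (hF : Measurable F) :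
    ∫⁻ x, F x ∂densityMeasure m p = ∫⁻ x, ENNReal.ofReal (p x) * F x ∂m := by
  rw [densityMeasure, lintegral_withDensity_eq_lintegral_mul _ hp.ennreal_ofReal hF]
  rfl

theorem integrable_densityMeasure_iff (hp : IsDensity m p) {F : Ω → ℝ} :
    Integrable F (densityMeasure m p) ↔ Integrable (fun x => p x * F x) m := by
  have := integrable_withDensity_iff_integrable_smul' (μ := m) (g := F)
    hp.measurable.ennreal_ofReal (Eventually.of_forall fun x => ENNReal.ofReal_lt_top)
  rw [densityMeasure, this]
  simp only [ENNReal.toReal_ofReal (hp.nonneg _), smul_eq_mul]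

theorem integral_densityMeasure (hp : IsDensity m p) (F : Ω → ℝ) :
    ∫ x, F x ∂densityMeasure m p = ∫ x, p x * F x ∂m := by
  have := integral_withDensity_eq_integral_toReal_smul (μ := m)
    hp.measurable.ennreal_ofReal (Eventually.of_forall fun x => ENNReal.ofReal_lt_top) F
  rw [densityMeasure, this]
  simp only [ENNReal.toReal_ofReal (hp.nonneg _), smul_eq_mul]

theorem ae_densityMeasure_iff (hp : IsDensity m p) {R : Ω → Prop} :
    (∀ᵐ x ∂densityMeasure m p, R x) ↔ ∀ᵐ x ∂m, 0 < p x → R x := by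
  rw [densityMeasure, ae_withDensity_iff hp.measurable.ennreal_ofReal]
  simp

/-- The density of `n` independent draws. -/
def prodDensity {n : ℕ} (p : Ω → ℝ) (z : Fin n → Ω) : ℝ := ∏ i, p (z i)

theorem measurable_prodDensity {n : ℕ} (hp : Measurable p) :
    Measurable (prodDensity p : (Fin n → Ω) → ℝ) := by
  unfold prodDensity
  fun_prop

theorem prodDensity_nonneg {Ω : Type*} {p : Ω → ℝ} {n : ℕ} (hp : ∀ x, 0 ≤ p x) (z : Fin n → Ω) :
    0 ≤ prodDensity p z :=
  Finset.prod_nonneg fun _ _ => hp _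

variable [SigmaFinite m]

theorem IsDensity.prodDensity {n : ℕ} (hp : IsDensity m p) :
    IsDensity (Measure.pi fun _ : Fin n => m) (prodDensity p) := by
  refine isDensity_of_integral (measurable_prodDensity hp.measurable)
    (prodDensity_nonneg hp.nonneg) ?_ ?_
  · exact Integrable.fintype_prod (μ := fun _ : Fin n => m) (f := fun _ => p)
      (fun _ => hp.integrable)
  · simp only [LocScale.prodDensity]
    rw [integral_fintype_prod_eq_prod (μ := fun _ : Fin n => m) (fun _ : Fin n => p)]
    simp [hp.integral_eq_one]

/-- On boxes the indicator of the product set times the product density is a product of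
one-coordinate functions, so Fubini applies, and boxes determine a product measure. -/
theorem pi_densityMeasure {n : ℕ} (hp : IsDensity m p) :
    (Measure.pi fun _ : Fin n => densityMeasure m p)
      = densityMeasure (Measure.pi fun _ : Fin n => m) (prodDensity p) := by
  have := hp.isProbabilityMeasure
  refine Measure.pi_eq fun s hs => ?_
  have hind : ∀ i, Integrable ((s i).indicator p) m := fun i => hp.integrable.indicator (hs i)
  have hind0 : ∀ i x, 0 ≤ (s i).indicator p x := fun i x =>
    Set.indicator_nonneg (fun x _ => hp.nonneg x) x
  have hset : ∀ i, densityMeasure m p (s i) = ENNReal.ofReal (∫ x, (s i).indicator p x ∂m) := by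
    intro i
    rw [densityMeasure, withDensity_apply _ (hs i), ← lintegral_indicator (hs i),
      ofReal_integral_eq_lintegral_ofReal (hind i) (Eventually.of_forall (hind0 i))]
    refine lintegral_congr fun x => ?_
    by_cases hx : x ∈ s i <;> simp [hx]
  have hmeas : MeasurableSet (Set.univ.pi s) := MeasurableSet.univ_pi hs
  rw [densityMeasure, withDensity_apply _ hmeas, ← lintegral_indicator hmeas]
  simp only [hset]
  rw [← ENNReal.ofReal_prod_of_nonneg fun i _ => integral_nonneg (hind0 i),
    ← integral_fintype_prod_eq_prod (μ := fun _ : Fin n => m) (fun i => (s i).indicator p),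
    ofReal_integral_eq_lintegral_ofReal
      (Integrable.fintype_prod (μ := fun _ : Fin n => m) hind)
      (Eventually.of_forall fun z => Finset.prod_nonneg fun i _ => hind0 i _)]
  refine lintegral_congr fun z => ?_
  by_cases hz : z ∈ Set.univ.pi s
  · rw [Set.indicator_of_mem hz]
    congr 1
    exact Finset.prod_congr rfl fun i _ =>
      (Set.indicator_of_mem (hz i (Set.mem_univ i)) p).symm
  · rw [Set.indicator_of_notMem hz]
    simp only [Set.mem_pi, Set.mem_univ, forall_const, not_forall] at hz
    obtain ⟨i, hi⟩ := hz
    rw [Finset.prod_eq_zero (Finset.mem_univ i) (Set.indicator_of_notMem hi p),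
      ENNReal.ofReal_zero]

end Densities

/-! ### Likelihood ratios, Hellinger affinity and maximum likelihood -/

section Likelihood

variable {Ω : Type*} [MeasurableSpace Ω] {m : Measure Ω} {p q : Ω → ℝ}

/-- The Kullback-Leibler divergence between densities, as the integral of a nonnegative function. -/
noncomputable def klLInt (m : Measure Ω) (p q : Ω → ℝ) : ENNReal :=
  ∫⁻ x, ENNReal.ofReal (p x * Real.log (p x / q x) + q x - p x) ∂m

/-- The support of `p` lies in that of `q` and the divergence of `p` from `q` is at most `D`. -/
structure KLBound (m : Measure Ω) (p q : Ω → ℝ) (D : ℝ) : Prop where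
  support : ∀ᵐ x ∂m, 0 < p x → 0 < q x
  bound : klLInt m p q ≤ ENNReal.ofReal D

theorem mul_log_div_add_sub_nonneg {a b : ℝ} (ha : 0 ≤ a) (hb : 0 < b) :
    0 ≤ a * Real.log (a / b) + b - a := by
  have h := mul_nonneg hb.le (InformationTheory.klFun_nonneg (div_nonneg ha hb.le))
  rw [InformationTheory.klFun] at h
  have : b * (a / b * Real.log (a / b) + 1 - a / b)
      = a * Real.log (a / b) + b - a := by field_simp
  rwa [this] at h

theorem KLBound.ae_nonneg {D : ℝ} (h : KLBound m p q D) (hp : IsDensity m p)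
    (hq : IsDensity m q) :
    ∀ᵐ x ∂m, 0 ≤ p x * Real.log (p x / q x) + q x - p x := by
  filter_upwards [h.support] with x hx
  rcases (hp.nonneg x).eq_or_lt with h0 | h0
  · simpa [← h0] using hq.nonneg x
  · exact mul_log_div_add_sub_nonneg h0.le (hx h0)

theorem KLBound.integrable_klIntegrand {D : ℝ} (h : KLBound m p q D) (hp : IsDensity m p)
    (hq : IsDensity m q) :
    Integrable (fun x => p x * Real.log (p x / q x) + q x - p x) m := by
  have := hp.measurable
  have := hq.measurable
  refine ⟨Measurable.aestronglyMeasurable (by fun_prop), ?_⟩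
  rw [hasFiniteIntegral_iff_ofReal (h.ae_nonneg hp hq)]
  exact h.bound.trans_lt ENNReal.ofReal_lt_top

theorem KLBound.integrable_log {D : ℝ} (h : KLBound m p q D) (hp : IsDensity m p)
    (hq : IsDensity m q) :
    Integrable (fun x => Real.log (p x / q x)) (densityMeasure m p) := by
  rw [integrable_densityMeasure_iff hp]
  refine (((h.integrable_klIntegrand hp hq).sub hq.integrable).add hp.integrable).congr ?_
  exact Eventually.of_forall fun x => by simp only [Pi.add_apply, Pi.sub_apply]; ring

/-- The summand q - p makes the divergence integrand nonnegative and contributes nothing to the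
integral, since both densities have mass one. -/
theorem KLBound.integral_log_le {D : ℝ} (h : KLBound m p q D) (hD : 0 ≤ D) (hp : IsDensity m p)
    (hq : IsDensity m q) :
    ∫ x, Real.log (p x / q x) ∂densityMeasure m p ≤ D := by
  rw [integral_densityMeasure hp]
  have h1 : ∫ x, p x * Real.log (p x / q x) ∂m
      = ∫ x, (p x * Real.log (p x / q x) + q x - p x) ∂m := by
    have hi := (h.integrable_klIntegrand hp hq)
    have e : (fun x => p x * Real.log (p x / q x))
        = fun x => (p x * Real.log (p x / q x) + q x - p x) - q x + p x := by
      funext x; ring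
    rw [e, integral_add (f := fun x => p x * Real.log (p x / q x) + q x - p x - q x)
      (hi.sub hq.integrable) hp.integrable, integral_sub hi hq.integrable,
      hp.integral_eq_one, hq.integral_eq_one]
    ring
  rw [h1, integral_eq_lintegral_of_nonneg_ae (h.ae_nonneg hp hq)
    (h.integrable_klIntegrand hp hq).aestronglyMeasurable]
  exact ENNReal.toReal_le_of_le_ofReal hD h.bound

/-- Likelihood ratio bound for the probability of an event under a change of density. -/
theorem densityMeasure_le_exp_mul_add {D : ℝ} (hp : IsDensity m p) (hq : IsDensity m q)
    (hpos : ∀ᵐ x ∂densityMeasure m p, 0 < p x ∧ 0 < q x)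
    (hint : Integrable (fun x => Real.log (p x / q x)) (densityMeasure m p))
    (hle : ∫ x, Real.log (p x / q x) ∂densityMeasure m p ≤ D)
    {A : Set Ω} (hA : MeasurableSet A) {t : ℝ} (ht : 0 < t) :
    densityMeasure m p A
      ≤ ENNReal.ofReal (Real.exp t) * densityMeasure m q A + ENNReal.ofReal ((D + 1) / t) := by
  have hpm := hp.measurable
  have hqm := hq.measurable
  -- On B the density p is dominated by e^t q. Off B the log-likelihood ratio exceeds t, which
  -- Markov's inequality makes unlikely.
  set B : Set Ω := {x | p x ≤ Real.exp t * q x} with hB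
  have hBm : MeasurableSet B := measurableSet_le hpm (by fun_prop)
  have hsplit : densityMeasure m p A ≤ densityMeasure m p (A ∩ B) + densityMeasure m p Bᶜ := by
    refine (measure_mono ?_).trans (measure_union_le _ _)
    intro x hx
    by_cases hxB : x ∈ B
    · exact Or.inl ⟨hx, hxB⟩
    · exact Or.inr hxB
  refine hsplit.trans (add_le_add ?_ ?_)
  · calc densityMeasure m p (A ∩ B)
        = ∫⁻ x in A ∩ B, ENNReal.ofReal (p x) ∂m := by
          rw [densityMeasure, withDensity_apply _ (hA.inter hBm)]
      _ ≤ ∫⁻ x in A ∩ B, ENNReal.ofReal (Real.exp t) * ENNReal.ofReal (q x) ∂m := by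
          refine setLIntegral_mono (by fun_prop) fun x hx => ?_
          rw [← ENNReal.ofReal_mul (Real.exp_pos t).le]
          exact ENNReal.ofReal_le_ofReal hx.2
      _ = ENNReal.ofReal (Real.exp t) * densityMeasure m q (A ∩ B) := by
          rw [lintegral_const_mul _ (by fun_prop), densityMeasure,
            withDensity_apply _ (hA.inter hBm)]
      _ ≤ _ := by gcongr; exact Set.inter_subset_left
  -- The log ratio alone may be negative. Since log x ≤ x - 1, adding q/p makes it at least 1, and
  -- the mean of q/p is at most 1: this is the source of D + 1.
  · have hqp : Integrable (fun x => q x / p x) (densityMeasure m p) := by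
      rw [integrable_densityMeasure_iff hp]
      refine hq.integrable.mono (by fun_prop) (Eventually.of_forall fun x => ?_)
      rcases (hp.nonneg x).eq_or_lt with h0 | h0
      · simp [← h0]
      · rw [mul_div_cancel₀ _ h0.ne']
    have hqp1 : ∫ x, q x / p x ∂densityMeasure m p ≤ 1 := by
      rw [integral_densityMeasure hp, ← hq.integral_eq_one]
      refine integral_mono_of_nonneg (Eventually.of_forall fun x => ?_) hq.integrable
        (Eventually.of_forall fun x => ?_)
      · exact mul_nonneg (hp.nonneg x) (div_nonneg (hq.nonneg x) (hp.nonneg x))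
      · rcases (hp.nonneg x).eq_or_lt with h0 | h0
        · simpa [← h0] using hq.nonneg x
        · simp only [mul_div_cancel₀ _ h0.ne', le_refl]
    have hG := (hint.add hqp).div_const t
    have hpt : ∀ᵐ x ∂densityMeasure m p, 0 ≤ (Real.log (p x / q x) + q x / p x) / t := by
      filter_upwards [hpos] with x hx
      have h1 := Real.log_le_sub_one_of_pos (div_pos hx.2 hx.1)
      rw [← inv_div, Real.log_inv] at h1
      rw [inv_div] at h1
      exact div_nonneg (by linarith) ht.le
    calc densityMeasure m p Bᶜ
        = ∫⁻ x, Bᶜ.indicator 1 x ∂densityMeasure m p := (lintegral_indicator_one hBm.compl).symm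
      _ ≤ ∫⁻ x, ENNReal.ofReal ((Real.log (p x / q x) + q x / p x) / t)
            ∂densityMeasure m p := by
          refine lintegral_mono_ae ?_
          filter_upwards [hpos] with x hx
          by_cases hxB : x ∈ B
          · simp [hxB]
          · have hlt : Real.exp t * q x < p x := not_le.mp hxB
            have h2 : t < Real.log (p x / q x) := by
              rw [Real.lt_log_iff_exp_lt (div_pos hx.1 hx.2), lt_div_iff₀ hx.2]
              exact hlt
            have h3 := div_pos hx.2 hx.1
            rw [Set.indicator_of_mem (by exact hxB), Pi.one_apply, ENNReal.one_le_ofReal,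
              le_div_iff₀ ht]
            linarith
      _ = ENNReal.ofReal (∫ x, (Real.log (p x / q x) + q x / p x) / t ∂densityMeasure m p) :=
          (ofReal_integral_eq_lintegral_ofReal hG hpt).symm
      _ ≤ _ := by
          refine ENNReal.ofReal_le_ofReal ?_
          rw [integral_div, integral_add hint hqp]
          gcongr

theorem sqrt_mul_le_add {a b : ℝ} (ha : 0 ≤ a) (hb : 0 ≤ b) : √(a * b) ≤ a + b := by
  rw [Real.sqrt_le_left (add_nonneg ha hb)]
  nlinarith

theorem integrable_sqrt_mul (hp : IsDensity m p) (hq : IsDensity m q) :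
    Integrable (fun x => √(p x * q x)) m := by
  have hpm := hp.measurable
  have hqm := hq.measurable
  refine (hp.integrable.add hq.integrable).mono (by fun_prop) (Eventually.of_forall fun x => ?_)
  simp only [Pi.add_apply]
  rw [Real.norm_of_nonneg (Real.sqrt_nonneg _),
    Real.norm_of_nonneg (add_nonneg (hp.nonneg x) (hq.nonneg x))]
  exact sqrt_mul_le_add (hp.nonneg x) (hq.nonneg x)

theorem integrable_hellinger (hp : IsDensity m p) (hq : IsDensity m q) :
    Integrable (fun y => (√(p y) - √(q y)) ^ 2) m := by
  have hpm := hp.measurable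
  have hqm := hq.measurable
  refine (hp.integrable.add hq.integrable).mono (by fun_prop) (Eventually.of_forall fun y => ?_)
  rw [Real.norm_of_nonneg (sq_nonneg _), Pi.add_apply,
    Real.norm_of_nonneg (add_nonneg (hp.nonneg y) (hq.nonneg y))]
  nlinarith [Real.sq_sqrt (hp.nonneg y), Real.sq_sqrt (hq.nonneg y), Real.sqrt_nonneg (p y),
    Real.sqrt_nonneg (q y), mul_nonneg (Real.sqrt_nonneg (p y)) (Real.sqrt_nonneg (q y))]

/-- The Hellinger affinity is determined by the squared Hellinger distance. -/
theorem integral_sqrt_mul_eq (hp : IsDensity m p) (hq : IsDensity m q) :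
    ∫ x, √(p x * q x) ∂m = 1 - (∫ x, (√(p x) - √(q x)) ^ 2 ∂m) / 2 := by
  have e : (fun x => (√(p x) - √(q x)) ^ 2) = fun x => p x + q x - 2 * √(p x * q x) := by
    funext x
    rw [Real.sqrt_mul (hp.nonneg x), sub_sq, Real.sq_sqrt (hp.nonneg x),
      Real.sq_sqrt (hq.nonneg x)]
    ring
  rw [e, integral_sub (f := fun x => p x + q x) (hp.integrable.add hq.integrable)
      ((integrable_sqrt_mul hp hq).const_mul 2),
    integral_add hp.integrable hq.integrable, hp.integral_eq_one, hq.integral_eq_one,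
    integral_const_mul]
  ring

theorem prodDensity_pos {Ω : Type*} {p : Ω → ℝ} {n : ℕ} {z : Fin n → Ω} (h : ∀ i, 0 < p (z i)) :
    0 < prodDensity p z :=
  Finset.prod_pos fun i _ => h i

theorem ae_pi_pos {D : ℝ} (h : KLBound m p q D) (hp : IsDensity m p) (n : ℕ) :
    ∀ᵐ z ∂(Measure.pi fun _ : Fin n => densityMeasure m p), ∀ i, 0 < p (z i) ∧ 0 < q (z i) := by
  have := hp.isProbabilityMeasure
  rw [ae_all_iff]
  intro i
  have h1 : ∀ᵐ x ∂densityMeasure m p, 0 < p x ∧ 0 < q x := by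
    rw [ae_densityMeasure_iff hp]
    filter_upwards [h.support] with x hx hpx using ⟨hpx, hx hpx⟩
  exact (measurePreserving_eval (fun _ : Fin n => densityMeasure m p) i).quasiMeasurePreserving.ae h1

theorem log_prodDensity_div {Ω : Type*} {p q : Ω → ℝ} {n : ℕ} {z : Fin n → Ω}
    (hz : ∀ i, 0 < p (z i) ∧ 0 < q (z i)) :
    Real.log (prodDensity p z / prodDensity q z) = ∑ i, Real.log (p (z i) / q (z i)) := by
  rw [prodDensity, prodDensity, ← Finset.prod_div_distrib,
    Real.log_prod fun i _ => (div_pos (hz i).1 (hz i).2).ne']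

theorem KLBound.integrable_log_eval {D : ℝ} (h : KLBound m p q D) (hp : IsDensity m p)
    (hq : IsDensity m q) {n : ℕ} (i : Fin n) :
    Integrable (fun z : Fin n → Ω => Real.log (p (z i) / q (z i)))
      (Measure.pi fun _ : Fin n => densityMeasure m p) :=
  have := hp.isProbabilityMeasure
  (measurePreserving_eval (fun _ : Fin n => densityMeasure m p) i).integrable_comp_of_integrable
    (h.integrable_log hp hq)

theorem KLBound.integrable_log_prod {D : ℝ} (h : KLBound m p q D) (hp : IsDensity m p)
    (hq : IsDensity m q) (n : ℕ) :
    Integrable (fun z => Real.log (prodDensity p z / prodDensity q z))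
      (Measure.pi fun _ : Fin n => densityMeasure m p) := by
  have := hp.isProbabilityMeasure
  have h1 : Integrable (fun z : Fin n → Ω => ∑ i, Real.log (p (z i) / q (z i)))
      (Measure.pi fun _ : Fin n => densityMeasure m p) :=
    integrable_finsetSum _ fun i _ => h.integrable_log_eval hp hq i
  refine h1.congr ?_
  filter_upwards [ae_pi_pos h hp n] with z hz
  exact (log_prodDensity_div hz).symm

theorem KLBound.integral_log_prod_le {D : ℝ} (h : KLBound m p q D) (hD : 0 ≤ D)
    (hp : IsDensity m p) (hq : IsDensity m q) (n : ℕ) :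
    ∫ z, Real.log (prodDensity p z / prodDensity q z)
      ∂(Measure.pi fun _ : Fin n => densityMeasure m p) ≤ n * D := by
  have := hp.isProbabilityMeasure
  have h1 : ∫ z, Real.log (prodDensity p z / prodDensity q z)
      ∂(Measure.pi fun _ : Fin n => densityMeasure m p)
      = ∫ z, ∑ i, Real.log (p (z i) / q (z i))
      ∂(Measure.pi fun _ : Fin n => densityMeasure m p) := by
    refine integral_congr_ae ?_
    filter_upwards [ae_pi_pos h hp n] with z hz
    exact log_prodDensity_div hz
  rw [h1, integral_finsetSum _ fun i _ => h.integrable_log_eval hp hq i]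
  have h2 : ∀ i : Fin n, ∫ z, Real.log (p (z i) / q (z i))
      ∂(Measure.pi fun _ : Fin n => densityMeasure m p) ≤ D := fun i => by
    rw [integral_comp_eval (μ := fun _ : Fin n => densityMeasure m p) (i := i)
      (f := fun x => Real.log (p x / q x)) (h.integrable_log hp hq).aestronglyMeasurable]
    exact h.integral_log_le hD hp hq
  calc _ ≤ ∑ _i : Fin n, D := Finset.sum_le_sum fun i _ => h2 i
    _ = n * D := by simp

variable [SigmaFinite m]

/-- Likelihood ratio bound for the probability of an event under `n` independent draws. -/
theorem pi_le_exp_mul_add {D : ℝ} (h : KLBound m p q D) (hD : 0 ≤ D) (hp : IsDensity m p)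
    (hq : IsDensity m q) (n : ℕ) {A : Set (Fin n → Ω)} (hA : MeasurableSet A) {t : ℝ}
    (ht : 0 < t) :
    (Measure.pi fun _ : Fin n => densityMeasure m p) A
      ≤ ENNReal.ofReal (Real.exp t) * (Measure.pi fun _ : Fin n => densityMeasure m q) A
        + ENNReal.ofReal ((n * D + 1) / t) := by
  have hpos := ae_pi_pos h hp n
  have hint := h.integrable_log_prod hp hq n
  have hle := h.integral_log_prod_le hD hp hq n
  rw [pi_densityMeasure hp] at hpos hint hle ⊢
  rw [pi_densityMeasure hq]
  refine densityMeasure_le_exp_mul_add hp.prodDensity hq.prodDensity ?_ hint hle hA ht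
  filter_upwards [hpos] with z hz
  exact ⟨prodDensity_pos fun i => (hz i).1, prodDensity_pos fun i => (hz i).2⟩

theorem mul_sqrt_div {a : ℝ} (ha : 0 ≤ a) (b : ℝ) : a * √(b / a) = √(a * b) := by
  rcases ha.eq_or_lt with rfl | h
  · simp
  · rw [show a * b = a ^ 2 * (b / a) by field_simp, Real.sqrt_mul (by positivity),
      Real.sqrt_sq ha]

theorem sqrt_prodDensity_mul {Ω : Type*} {p q : Ω → ℝ} (hp : ∀ x, 0 ≤ p x)
    (hq : ∀ x, 0 ≤ q x) {n : ℕ} (z : Fin n → Ω) :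
    √(prodDensity p z * prodDensity q z) = ∏ i, √(p (z i) * q (z i)) := by
  rw [prodDensity, prodDensity, ← Finset.prod_mul_distrib,
    Real.sqrt_prod _ fun i _ => mul_nonneg (hp _) (hq _)]

theorem integrable_sqrt_likelihoodRatio (hp : IsDensity m p) (hq : IsDensity m q) (n : ℕ) :
    Integrable (fun z => √(prodDensity q z / prodDensity p z))
      (Measure.pi fun _ : Fin n => densityMeasure m p) := by
  rw [pi_densityMeasure hp, integrable_densityMeasure_iff hp.prodDensity]
  simp only [mul_sqrt_div (prodDensity_nonneg hp.nonneg _)]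
  exact integrable_sqrt_mul hp.prodDensity hq.prodDensity

/-- The affinity is multiplicative over independent draws. No support condition is needed: where the
density of p vanishes, both sides of `mul_sqrt_div` are zero. -/
theorem integral_sqrt_likelihoodRatio (hp : IsDensity m p) (hq : IsDensity m q) (n : ℕ) :
    ∫ z, √(prodDensity q z / prodDensity p z) ∂(Measure.pi fun _ : Fin n => densityMeasure m p)
      = (∫ x, √(p x * q x) ∂m) ^ n := by
  rw [pi_densityMeasure hp, integral_densityMeasure hp.prodDensity]
  simp only [mul_sqrt_div (prodDensity_nonneg hp.nonneg _),
    sqrt_prodDensity_mul hp.nonneg hq.nonneg]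
  rw [integral_fintype_prod_eq_prod (μ := fun _ : Fin n => m)
    (fun (_ : Fin n) x => √(p x * q x))]
  simp

/-- The Hellinger risk of a maximum likelihood estimator over a finite family of densities. -/
theorem lintegral_maximumLikelihood_le {ι : Type*} [Fintype ι] {P : ι → Ω → ℝ}
    (hp : IsDensity m p) (hP : ∀ j, IsDensity m (P j)) {j₀ : ι} {D : ℝ} (hD : 0 ≤ D)
    (hKL : KLBound m p (P j₀) D) {n : ℕ} {j' : (Fin n → Ω) → ι}
    (hmax : ∀ z j, prodDensity (P j) z ≤ prodDensity (P (j' z)) z)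
    {d : ι → ℝ} (hd0 : ∀ j, 0 ≤ d j) (hd : ∀ j, d j ≤ 1 - ∫ x, √(p x * P j x) ∂m) :
    ∫⁻ z, ENNReal.ofReal (n * d (j' z)) ∂(Measure.pi fun _ : Fin n => densityMeasure m p)
      ≤ ENNReal.ofReal (Real.log (Fintype.card ι) + n * D / 2) := by
  have := hp.isProbabilityMeasure
  set Pn := Measure.pi fun _ : Fin n => densityMeasure m p with hPn
  have : IsProbabilityMeasure Pn := by rw [hPn]; infer_instance
  set N : ℝ := (Fintype.card ι : ℝ) with hN
  have hNpos : 0 < N := by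
    have : Nonempty ι := ⟨j₀⟩
    exact Nat.cast_pos.2 Fintype.card_pos
  -- Summing over all candidates removes the dependence of the maximizer on the data. The weight
  -- exp(n d j) is cancelled by the n-th power of the affinity, at most exp(-n d j), so each term
  -- has mean at most 1.
  set T : (Fin n → Ω) → ℝ :=
    fun z => ∑ j, √(prodDensity (P j) z / prodDensity p z) * Real.exp (n * d j) with hT
  have hTi : Integrable T Pn := integrable_finsetSum _ fun j _ =>
    (integrable_sqrt_likelihoodRatio hp (hP j) n).mul_const _
  have hTle : ∫ z, T z ∂Pn ≤ N := by
    rw [hT, integral_finsetSum _ fun j _ =>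
      (integrable_sqrt_likelihoodRatio hp (hP j) n).mul_const _]
    calc _ ≤ ∑ _j : ι, (1 : ℝ) := by
          refine Finset.sum_le_sum fun j _ => ?_
          rw [integral_mul_const, integral_sqrt_likelihoodRatio hp (hP j)]
          have h0 : 0 ≤ ∫ x, √(p x * P j x) ∂m := integral_nonneg fun x => Real.sqrt_nonneg _
          have h1 : ∫ x, √(p x * P j x) ∂m ≤ Real.exp (-d j) := by
            have := Real.add_one_le_exp (-d j)
            linarith [hd j]
          calc _ ≤ Real.exp (-d j) ^ n * Real.exp (n * d j) := by gcongr
            _ = 1 := by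
              rw [← Real.exp_nat_mul, ← Real.exp_add]
              simp
      _ = N := by simp [hN]
  have hlogi := hKL.integrable_log_prod hp (hP j₀) n
  have hlogle := hKL.integral_log_prod_le hD hp (hP j₀) n
  -- From log(T/N) ≤ T/N - 1: a bound for log T that is linear in T, so no integrability of log T is
  -- needed. The last term is what remains after comparing the maximizer with the candidate j₀.
  set G : (Fin n → Ω) → ℝ := fun z =>
    T z / N + (Real.log N - 1) + Real.log (prodDensity p z / prodDensity (P j₀) z) / 2 with hG
  have hGi : Integrable G Pn :=
    ((hTi.div_const N).add (integrable_const _)).add (hlogi.div_const 2)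
  have hpt : ∀ᵐ z ∂Pn, n * d (j' z) ≤ G z := by
    filter_upwards [ae_pi_pos hKL hp n] with z hz
    have hpz : 0 < prodDensity p z := prodDensity_pos fun i => (hz i).1
    have hqz : 0 < prodDensity (P j₀) z := prodDensity_pos fun i => (hz i).2
    have h1 : √(prodDensity (P j₀) z / prodDensity p z) * Real.exp (n * d (j' z)) ≤ T z := by
      calc _ ≤ √(prodDensity (P (j' z)) z / prodDensity p z) * Real.exp (n * d (j' z)) := by
            gcongr
            exact hmax z j₀
        _ ≤ T z := Finset.single_le_sum
            (f := fun j => √(prodDensity (P j) z / prodDensity p z) * Real.exp (n * d j))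
            (fun j _ => by positivity) (Finset.mem_univ _)
    have hs : 0 < √(prodDensity (P j₀) z / prodDensity p z) := Real.sqrt_pos.2 (div_pos hqz hpz)
    have h2 := Real.log_le_log (by positivity) h1
    rw [Real.log_mul hs.ne' (Real.exp_pos _).ne', Real.log_exp, Real.log_sqrt (by positivity),
      ← inv_div (prodDensity p z), Real.log_inv] at h2
    have hTpos : 0 < T z := lt_of_lt_of_le (by positivity) h1
    have h3 := Real.log_le_sub_one_of_pos (div_pos hTpos hNpos)
    rw [Real.log_div hTpos.ne' hNpos.ne'] at h3
    simp only [hG]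
    linarith
  calc ∫⁻ z, ENNReal.ofReal (n * d (j' z)) ∂Pn
      ≤ ∫⁻ z, ENNReal.ofReal (G z) ∂Pn := by
        refine lintegral_mono_ae ?_
        filter_upwards [hpt] with z hz using ENNReal.ofReal_le_ofReal hz
    _ = ENNReal.ofReal (∫ z, G z ∂Pn) := by
        refine (ofReal_integral_eq_lintegral_ofReal hGi ?_).symm
        filter_upwards [hpt] with z hz
        exact le_trans (mul_nonneg n.cast_nonneg (hd0 _)) hz
    _ ≤ _ := by
        refine ENNReal.ofReal_le_ofReal ?_
        simp only [hG]
        rw [integral_add (f := fun z => T z / N + (Real.log N - 1))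
            ((hTi.div_const N).add (integrable_const _)) (hlogi.div_const 2),
          integral_add (hTi.div_const N) (integrable_const _), integral_div, integral_div,
          integral_const]
        have h4 : (∫ z, T z ∂Pn) / N ≤ 1 := (div_le_one hNpos).2 hTle
        simp only [probReal_univ, smul_eq_mul]
        linarith

end Likelihood

/-! ### Divergence integrand and agreement with `klDiv` -/

section KLTerm

/-- The integrand of the Kullback-Leibler divergence, infinite where absolute continuity fails. -/
noncomputable def klTerm (a b : ℝ) : ENNReal :=
  if b ≤ 0 ∧ 0 < a then ⊤ else ENNReal.ofReal (a * Real.log (a / b) + b - a)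

theorem measurable_klTerm : Measurable fun z : ℝ × ℝ => klTerm z.1 z.2 := by
  unfold klTerm
  refine Measurable.ite ?_ measurable_const (by fun_prop)
  exact (measurableSet_le measurable_snd measurable_const).inter
    (measurableSet_lt measurable_const measurable_fst)

/-- Homogeneity of degree one, so that the Jacobian of an affine change of variables cancels. -/
theorem klTerm_mul {c : ℝ} (hc : 0 < c) (a b : ℝ) :
    klTerm (c * a) (c * b) = ENNReal.ofReal c * klTerm a b := by
  unfold klTerm
  have h1 : (c * b ≤ 0 ∧ 0 < c * a) ↔ (b ≤ 0 ∧ 0 < a) := by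
    rw [mul_pos_iff_of_pos_left hc, mul_nonpos_iff_pos_imp_nonpos]
    constructor
    · rintro ⟨h, h'⟩
      exact ⟨h.1 hc, h'⟩
    · rintro ⟨h, h'⟩
      exact ⟨⟨fun _ => h, fun _ => hc.le⟩, h'⟩
  by_cases h : b ≤ 0 ∧ 0 < a
  · rw [if_pos h, if_pos (h1.2 h), ENNReal.mul_top (by simpa using hc)]
  · rw [if_neg h, if_neg (h1.not.2 h), ← ENNReal.ofReal_mul hc.le, mul_div_mul_left _ _ hc.ne']
    congr 1
    ring

variable {Ω : Type*} [MeasurableSpace Ω] {m : Measure Ω} {p q : Ω → ℝ}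

theorem Measurable.klTerm (hp : Measurable p) (hq : Measurable q) :
    Measurable fun x => klTerm (p x) (q x) :=
  measurable_klTerm.comp (hp.prodMk hq)

/-- A finite integral makes the value `⊤` occur only on a null set, which is the support condition.
With real logarithms alone, points with q = 0 < p would go unnoticed, since log(p/0) = 0. -/
theorem klBound_of_lintegral_klTerm_le {D : ℝ} (hp : Measurable p) (hq : Measurable q)
    (h : ∫⁻ x, klTerm (p x) (q x) ∂m ≤ ENNReal.ofReal D) : KLBound m p q D := by
  have hmeas := Measurable.klTerm hp hq
  refine ⟨?_, (lintegral_mono fun x => ?_).trans h⟩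
  · filter_upwards [ae_lt_top hmeas (h.trans_lt ENNReal.ofReal_lt_top).ne] with x hx hpx
    by_contra hq0
    rw [klTerm, if_pos ⟨not_lt.1 hq0, hpx⟩] at hx
    exact lt_irrefl _ hx
  · unfold klTerm
    split_ifs <;> simp

/-- A finite divergence forces absolute continuity, so p/q is the Radon–Nikodym derivative, and q ·
klFun(p/q) is the integrand. -/
theorem lintegral_klTerm_eq_klDiv [SigmaFinite m] (hp : IsDensity m p) (hq : IsDensity m q)
    (hfin : InformationTheory.klDiv (densityMeasure m p) (densityMeasure m q) ≠ ⊤) :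
    ∫⁻ x, klTerm (p x) (q x) ∂m
      = InformationTheory.klDiv (densityMeasure m p) (densityMeasure m q) := by
  have := hp.isProbabilityMeasure
  have := hq.isProbabilityMeasure
  have hpm := hp.measurable
  have hqm := hq.measurable
  have hac := (InformationTheory.klDiv_ne_top_iff.1 hfin).1
  have hsupp : ∀ᵐ x ∂m, 0 < p x → 0 < q x := by
    rw [← ae_densityMeasure_iff hp]
    exact hac.ae_le ((ae_densityMeasure_iff hq).2 (Eventually.of_forall fun x hx => hx))
  set r : Ω → ENNReal := fun x => ENNReal.ofReal (p x / q x) with hr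
  have hrm : Measurable r := by fun_prop
  have hP : densityMeasure m p = (densityMeasure m q).withDensity r := by
    rw [densityMeasure, densityMeasure, ← withDensity_mul _ hqm.ennreal_ofReal hrm]
    refine withDensity_congr_ae ?_
    filter_upwards [hsupp] with x hx
    rw [Pi.mul_apply, hr, ← ENNReal.ofReal_mul (hq.nonneg x)]
    congr 1
    rcases (hq.nonneg x).eq_or_lt with h0 | h0
    · rw [← h0, zero_mul]
      by_contra hne
      exact (hx (lt_of_le_of_ne (hp.nonneg x) (Ne.symm hne))).ne h0
    · rw [mul_div_cancel₀ _ h0.ne']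
  have hrn : (densityMeasure m p).rnDeriv (densityMeasure m q) =ᵐ[densityMeasure m q] r := by
    rw [hP]
    exact Measure.rnDeriv_withDensity _ hrm
  have hk : Measurable fun x => ENNReal.ofReal (InformationTheory.klFun (p x / q x)) := by
    have := InformationTheory.measurable_klFun
    fun_prop
  rw [InformationTheory.klDiv_eq_lintegral_klFun_of_ac hac]
  have h2 : ∫⁻ x, ENNReal.ofReal (InformationTheory.klFun
        ((densityMeasure m p).rnDeriv (densityMeasure m q) x).toReal) ∂densityMeasure m q
      = ∫⁻ x, ENNReal.ofReal (InformationTheory.klFun (p x / q x)) ∂densityMeasure m q := by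
    refine lintegral_congr_ae ?_
    filter_upwards [hrn] with x hx
    rw [hx, hr, ENNReal.toReal_ofReal (div_nonneg (hp.nonneg x) (hq.nonneg x))]
  rw [h2, lintegral_densityMeasure hqm hk]
  refine lintegral_congr_ae ?_
  filter_upwards [hsupp] with x hx
  rw [klTerm, if_neg fun h => absurd (hx h.2) (not_lt.2 h.1), ← ENNReal.ofReal_mul (hq.nonneg x),
    InformationTheory.klFun]
  rcases (hq.nonneg x).eq_or_lt with h0 | h0
  · have hp0 : p x = 0 := by
      by_contra hne
      exact (hx (lt_of_le_of_ne (hp.nonneg x) (Ne.symm hne))).ne h0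
    simp [← h0, hp0]
  · congr 1
    field_simp

end KLTerm

/-! ### The location-scale family: equivariance and upper divergence bound -/

section Family

variable {f : ℝ → ℝ}

theorem lintegral_comp_affine {s : ℝ} (hs : 0 < s) (η : ℝ) {g : ℝ → ENNReal} (hg : Measurable g) :
    ∫⁻ y, g y = ENNReal.ofReal s * ∫⁻ u, g (η + s * u) := by
  have h1 : ∫⁻ y, g y = ∫⁻ y, g (η + y) := (lintegral_add_left_eq_self g η).symm
  have h2 : ∫⁻ y, g (η + y) = ENNReal.ofReal s * ∫⁻ u, g (η + s * u) := by
    conv_lhs => rw [← Real.smul_map_volume_mul_left hs.ne']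
    rw [lintegral_smul_measure, abs_of_pos hs, lintegral_map (by fun_prop) (by fun_prop)]
    rfl
  rw [h1, h2]

theorem lsDensity_zero_one (f : ℝ → ℝ) : lsDensity f 0 1 = f := by
  funext y
  simp [lsDensity]

/-- Standardizing by (η, s) turns (η', s') into a relative parameter. Divergence and Hellinger
distance of a pair thus reduce to comparisons with f itself. -/
theorem lsDensity_affine (f : ℝ → ℝ) (η η' : ℝ) {s s' : ℝ} (hs : 0 < s) (hs' : 0 < s') (u : ℝ) :
    lsDensity f η' s' (η + s * u) = s⁻¹ * lsDensity f ((η' - η) / s) (s' / s) u := by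
  unfold lsDensity
  have e : (u - (η' - η) / s) / (s' / s) = (η + s * u - η') / s' := by
    field_simp
    ring
  rw [e]
  field_simp

theorem lsDensity_affine_self (f : ℝ → ℝ) (η : ℝ) {s : ℝ} (hs : 0 < s) (u : ℝ) :
    lsDensity f η s (η + s * u) = s⁻¹ * f u := by
  rw [lsDensity_affine f η η hs hs, sub_self, zero_div, div_self hs.ne', lsDensity_zero_one]

theorem measurable_lsDensity (hf : Measurable f) (η s : ℝ) :
    Measurable (lsDensity f η s) := by
  unfold lsDensity
  fun_prop

theorem lsDensity_nonneg (hf : ∀ y, 0 ≤ f y) {s : ℝ} (hs : 0 < s) (η y : ℝ) :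
    0 ≤ lsDensity f η s y :=
  mul_nonneg (by positivity) (hf _)

theorem isDensity_lsDensity (hf : IsDensity volume f) (η : ℝ) {s : ℝ} (hs : 0 < s) :
    IsDensity volume (lsDensity f η s) := by
  have hm := measurable_lsDensity hf.measurable η s
  refine ⟨hm, lsDensity_nonneg hf.nonneg hs η, ?_⟩
  have hfm := hf.measurable
  rw [lintegral_comp_affine hs η hm.ennreal_ofReal]
  simp only [lsDensity_affine_self f η hs]
  simp only [ENNReal.ofReal_mul (inv_nonneg.2 hs.le)]
  rw [lintegral_const_mul _ (by fun_prop), hf.lintegral_eq_one, mul_one,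
    ← ENNReal.ofReal_mul hs.le, mul_inv_cancel₀ hs.ne', ENNReal.ofReal_one]

theorem lintegral_klTerm_lsDensity (hf : IsDensity volume f) (η η' : ℝ) {s s' : ℝ}
    (hs : 0 < s) (hs' : 0 < s') :
    ∫⁻ y, klTerm (lsDensity f η s y) (lsDensity f η' s' y)
      = ∫⁻ u, klTerm (f u) (lsDensity f ((η' - η) / s) (s' / s) u) := by
  have hm : ∀ η s : ℝ, Measurable (lsDensity f η s) := measurable_lsDensity hf.measurable
  have hfm := hf.measurable
  rw [lintegral_comp_affine hs η (Measurable.klTerm (hm η s) (hm η' s'))]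
  simp only [lsDensity_affine_self f η hs, lsDensity_affine f η η' hs hs',
    klTerm_mul (inv_pos.2 hs)]
  rw [lintegral_const_mul _ (Measurable.klTerm hfm (hm _ _)), ← mul_assoc,
    ← ENNReal.ofReal_mul hs.le, mul_inv_cancel₀ hs.ne', ENNReal.ofReal_one, one_mul]

/-- The squared Hellinger distance between `f` and the member `(η, σ)` of the family. -/
noncomputable def hellSq (f : ℝ → ℝ) (θ : ℝ × ℝ) : ENNReal :=
  ∫⁻ y, ENNReal.ofReal ((√(f y) - √(lsDensity f θ.1 θ.2 y)) ^ 2)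

theorem lintegral_hellinger_lsDensity (hf : IsDensity volume f) (η η' : ℝ) {s s' : ℝ}
    (hs : 0 < s) (hs' : 0 < s') :
    ∫⁻ y, ENNReal.ofReal ((√(lsDensity f η s y) - √(lsDensity f η' s' y)) ^ 2)
      = hellSq f ((η' - η) / s, s' / s) := by
  have hm : ∀ η s : ℝ, Measurable (lsDensity f η s) := measurable_lsDensity hf.measurable
  have hfm := hf.measurable
  have h1 := hm η s
  have h2 := hm η' s'
  have h3 := hm ((η' - η) / s) (s' / s)
  rw [lintegral_comp_affine hs η (by fun_prop), hellSq]
  have e : ∀ a b : ℝ, ENNReal.ofReal ((√(s⁻¹ * a) - √(s⁻¹ * b)) ^ 2)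
      = ENNReal.ofReal s⁻¹ * ENNReal.ofReal ((√a - √b) ^ 2) := by
    intro a b
    rw [← ENNReal.ofReal_mul (inv_nonneg.2 hs.le), Real.sqrt_mul (inv_nonneg.2 hs.le),
      Real.sqrt_mul (inv_nonneg.2 hs.le), ← mul_sub, mul_pow, Real.sq_sqrt (inv_nonneg.2 hs.le)]
  simp only [lsDensity_affine_self f η hs, lsDensity_affine f η η' hs hs', e]
  rw [lintegral_const_mul _ (by fun_prop), ← mul_assoc,
    ← ENNReal.ofReal_mul hs.le, mul_inv_cancel₀ hs.ne', ENNReal.ofReal_one, one_mul]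

/-- The squared distance of the parameter `(η, σ)` from `(0, 1)`. -/
def paramSq (θ : ℝ × ℝ) : ℝ := θ.1 ^ 2 + (1 - θ.2) ^ 2

theorem paramSq_nonneg (θ : ℝ × ℝ) : 0 ≤ paramSq θ := by unfold paramSq; positivity

theorem paramSq_pos {θ : ℝ × ℝ} (h : θ ≠ (0, 1)) : 0 < paramSq θ := by
  refine lt_of_le_of_ne (paramSq_nonneg θ) fun h0 => h ?_
  unfold paramSq at h0
  have h1 : θ.1 = 0 := by nlinarith [sq_nonneg θ.1, sq_nonneg (1 - θ.2)]
  have h2 : 1 - θ.2 = 0 := by nlinarith [sq_nonneg θ.1, sq_nonneg (1 - θ.2)]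
  ext
  · exact h1
  · simpa using (by linarith : θ.2 = 1)

theorem continuous_paramSq : Continuous paramSq := by unfold paramSq; fun_prop

/-- The property is local, hence passes to compact sets. At (0,1) it is the quadratic hypothesis;
elsewhere the divergence is locally bounded and the squared distance to (0,1) is bounded below. -/
theorem exists_lsKL_le_of_isCompact (hKL : KLFiniteContinuous f) (hloc : KLLocallyQuadratic f)
    {B : Set (ℝ × ℝ)} (hB : IsCompact B) (hBpos : ∀ θ ∈ B, 0 < θ.2) :
    ∃ K : ℝ, 0 < K ∧ ∀ θ ∈ B, lsKL f θ ≤ ENNReal.ofReal (K * paramSq θ) := by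
  refine hB.induction_on (p := fun s => ∃ K : ℝ, 0 < K ∧ ∀ θ ∈ s,
    lsKL f θ ≤ ENNReal.ofReal (K * paramSq θ)) ⟨1, one_pos, by simp⟩ ?_ ?_ ?_
  · rintro s t hst ⟨K, hK, h⟩
    exact ⟨K, hK, fun θ hθ => h θ (hst hθ)⟩
  · rintro s t ⟨K, hK, h⟩ ⟨L, hL, h'⟩
    refine ⟨K + L, by positivity, ?_⟩
    rintro θ (hθ | hθ)
    · refine (h θ hθ).trans (ENNReal.ofReal_le_ofReal ?_)
      nlinarith [paramSq_nonneg θ]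
    · refine (h' θ hθ).trans (ENNReal.ofReal_le_ofReal ?_)
      nlinarith [paramSq_nonneg θ]
  · intro θ₀ hθ₀
    suffices h : ∃ K : ℝ, 0 < K ∧ ∀ᶠ θ in 𝓝 θ₀, lsKL f θ ≤ ENNReal.ofReal (K * paramSq θ) by
      obtain ⟨K, hK, h⟩ := h
      exact ⟨_, mem_nhdsWithin_of_mem_nhds h, K, hK, fun θ hθ => hθ⟩
    by_cases h0 : θ₀ = (0, 1)
    · obtain ⟨K, hK⟩ := hloc
      refine ⟨max K 1, by positivity, ?_⟩
      rw [h0]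
      filter_upwards [hK] with θ hθ
      refine hθ.trans (ENNReal.ofReal_le_ofReal ?_)
      exact mul_le_mul_of_nonneg_right (le_max_left _ _) (paramSq_nonneg θ)
    · have hr := paramSq_pos h0
      have hopen : IsOpen {θ : ℝ × ℝ | 0 < θ.2} := isOpen_lt continuous_const continuous_snd
      have hc : ContinuousAt (lsKL f) θ₀ := hKL.2.continuousAt (hopen.mem_nhds (hBpos θ₀ hθ₀))
      have hfin := hKL.1 θ₀ (hBpos θ₀ hθ₀)
      set L := (lsKL f θ₀).toReal + 1 with hL
      have hLpos : 0 < L := by positivity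
      have hlt : lsKL f θ₀ < ENNReal.ofReal L := by
        rw [ENNReal.lt_ofReal_iff_toReal_lt hfin.ne]
        linarith
      refine ⟨L / (paramSq θ₀ / 2), by positivity, ?_⟩
      filter_upwards [hc.eventually_lt_const hlt,
        continuous_paramSq.continuousAt.eventually_const_lt (half_lt_self hr)] with θ h1 h2
      refine h1.le.trans (ENNReal.ofReal_le_ofReal ?_)
      rw [div_mul_eq_mul_div, le_div_iff₀ (by positivity)]
      gcongr

end Family

/-! ### Identifiability -/

section Identifiability

/-- A probability measure without atoms is not invariant under a nontrivial affine map. -/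
theorem map_affine_ne (P : Measure ℝ) [IsProbabilityMeasure P] [NullSingletonClass P] {η s : ℝ} (hs : 0 < s)
    (h : (η, s) ≠ (0, 1)) : P.map (fun u => η + s * u) ≠ P := by
  intro heq
  have hinv : ∀ A : Set ℝ, MeasurableSet A → P ((fun u => η + s * u) ⁻¹' A) = P A := by
    intro A hA
    conv_rhs => rw [← heq]
    rw [Measure.map_apply (by fun_prop) hA]
  -- A translation leaves the distribution function periodic, hence constant and equal to its limit
  -- 1 everywhere. Any other affine map contracts towards its fixed point, forwards or backwards, so
  -- every ball has the mass of that point, which is zero.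
  by_cases hs1 : s = 1
  · subst hs1
    have hη : η ≠ 0 := fun h0 => h (by rw [h0])
    have hG : ∀ a, P (Set.Iic (a - η)) = P (Set.Iic a) := by
      intro a
      rw [← hinv (Set.Iic a) measurableSet_Iic]
      congr 1
      ext u
      simp only [Set.mem_preimage, Set.mem_Iic, one_mul]
      constructor <;> intro <;> linarith
    have hG' : ∀ a, P (Set.Iic (a + |η|)) = P (Set.Iic a) := by
      intro a
      rcases abs_choice η with h1 | h1
      · rw [h1, ← hG (a + η), add_sub_cancel_right]
      · rw [h1, ← sub_eq_add_neg, hG]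
    have hGn : ∀ (a : ℝ) (n : ℕ), P (Set.Iic (a + n * |η|)) = P (Set.Iic a) := by
      intro a n
      induction n with
      | zero => simp
      | succ n ih =>
        rw [← ih, ← hG' (a + n * |η|)]
        congr 2
        push_cast
        ring
    have hone : ∀ a, P (Set.Iic a) = 1 := by
      intro a
      have h1 : Tendsto (fun n : ℕ => a + n * |η|) atTop atTop :=
        tendsto_atTop_add_const_left _ _
          (tendsto_natCast_atTop_atTop.atTop_mul_const (abs_pos.2 hη))
      have h2 := (tendsto_measure_Iic_atTop P).comp h1
      simp only [Function.comp_def, hGn, measure_univ] at h2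
      exact tendsto_nhds_unique tendsto_const_nhds h2
    have hu : P (⋃ n : ℕ, (Set.Iic (-(n : ℝ)))ᶜ) = 0 :=
      measure_iUnion_null fun n => (prob_compl_eq_zero_iff measurableSet_Iic).2 (hone _)
    have huniv : ⋃ n : ℕ, (Set.Iic (-(n : ℝ)))ᶜ = Set.univ := by
      refine Set.eq_univ_of_forall fun x => ?_
      obtain ⟨n, hn⟩ := exists_nat_gt (-x)
      simp only [Set.mem_iUnion, Set.mem_compl_iff, Set.mem_Iic, not_le]
      exact ⟨n, by linarith⟩
    rw [huniv, measure_univ] at hu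
    exact one_ne_zero hu
  · set y₀ := η / (1 - s) with hy₀
    have hs1' : 1 - s ≠ 0 := fun h0 => hs1 (by linarith)
    have hfix : η + s * y₀ = y₀ := by
      rw [hy₀]
      field_simp
      ring
    have hF : ∀ r, P (Metric.closedBall y₀ (r / s)) = P (Metric.closedBall y₀ r) := by
      intro r
      rw [← hinv (Metric.closedBall y₀ r) measurableSet_closedBall]
      congr 1
      ext u
      simp only [Set.mem_preimage, Metric.mem_closedBall, Real.dist_eq]
      have e : η + s * u - y₀ = s * (u - y₀) := by
        conv_lhs => rw [← hfix]
        ring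
      rw [e, abs_mul, abs_of_pos hs, le_div_iff₀ hs, mul_comm]
    obtain ⟨ρ, hρ0, hρ1, hρ⟩ : ∃ ρ : ℝ, 0 < ρ ∧ ρ < 1 ∧
        ∀ r, P (Metric.closedBall y₀ (ρ * r)) = P (Metric.closedBall y₀ r) := by
      rcases lt_or_gt_of_ne hs1 with h1 | h1
      · refine ⟨s, hs, h1, fun r => ?_⟩
        rw [← hF (s * r), mul_div_cancel_left₀ _ hs.ne']
      · refine ⟨s⁻¹, inv_pos.2 hs, inv_lt_one_of_one_lt₀ h1, fun r => ?_⟩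
        rw [← hF r, div_eq_inv_mul]
    have hρn : ∀ (r : ℝ) (n : ℕ),
        P (Metric.closedBall y₀ (ρ ^ n * r)) = P (Metric.closedBall y₀ r) := by
      intro r n
      induction n with
      | zero => simp
      | succ n ih => rw [← ih, ← hρ (ρ ^ n * r), pow_succ']; ring_nf
    have hz : ∀ k : ℕ, P (Metric.closedBall y₀ (k : ℝ)) = 0 := by
      intro k
      have hanti : Antitone fun n : ℕ => Metric.closedBall y₀ (ρ ^ n * k) := by
        intro a b hab
        refine Metric.closedBall_subset_closedBall ?_
        exact mul_le_mul_of_nonneg_right (pow_le_pow_of_le_one hρ0.le hρ1.le hab) k.cast_nonneg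
      have hlim := tendsto_measure_iInter_atTop (μ := P)
        (fun n : ℕ => (measurableSet_closedBall (x := y₀)
          (ε := ρ ^ n * k)).nullMeasurableSet) hanti ⟨0, measure_ne_top _ _⟩
      have hinter : ⋂ n : ℕ, Metric.closedBall y₀ (ρ ^ n * k) = {y₀} := by
        ext u
        simp only [Set.mem_iInter, Metric.mem_closedBall, Set.mem_singleton_iff]
        constructor
        · intro hu
          have h0 : Tendsto (fun n : ℕ => ρ ^ n * (k : ℝ)) atTop (𝓝 (0 * k)) :=
            (tendsto_pow_atTop_nhds_zero_of_lt_one hρ0.le hρ1).mul_const _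
          rw [zero_mul] at h0
          exact dist_le_zero.1 (ge_of_tendsto' h0 hu)
        · rintro rfl n
          rw [dist_self]
          positivity
      rw [hinter, measure_singleton] at hlim
      simp only [Function.comp_def, hρn] at hlim
      exact tendsto_nhds_unique tendsto_const_nhds hlim
    have hu : P Set.univ = 0 := by
      rw [← Metric.iUnion_closedBall_nat y₀]
      exact measure_iUnion_null hz
    rw [measure_univ] at hu
    exact one_ne_zero hu

end Identifiability

/-! ### Lower Hellinger bounds -/

section Hellinger

variable {f : ℝ → ℝ}

/-- Factor a - b through the square roots and apply the weighted arithmetic-geometric inequality.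
The free weight t replaces Cauchy–Schwarz after integration. -/
theorem abs_sub_le_hellinger {a b t : ℝ} (ha : 0 ≤ a) (hb : 0 ≤ b) (ht : 0 < t) :
    |a - b| ≤ (√a - √b) ^ 2 / (2 * t) + t * (a + b) := by
  have h1 : |a - b| = |√a - √b| * (√a + √b) := by
    rw [← abs_of_nonneg (add_nonneg (Real.sqrt_nonneg a) (Real.sqrt_nonneg b)), ← abs_mul]
    congr 1
    ring_nf
    rw [Real.sq_sqrt ha, Real.sq_sqrt hb]
  have h2 : (√a + √b) ^ 2 ≤ 2 * (a + b) := by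
    have := sq_nonneg (√a - √b)
    have e1 := Real.sq_sqrt ha
    have e2 := Real.sq_sqrt hb
    nlinarith
  have h3 : |√a - √b| * (√a + √b)
      ≤ (√a - √b) ^ 2 / (2 * t) + t / 2 * (√a + √b) ^ 2 := by
    rw [← sq_abs (√a - √b)]
    have := sq_nonneg (|√a - √b| - t * (√a + √b))
    have e : |√a - √b| ^ 2 / (2 * t) + t / 2 * (√a + √b) ^ 2 - |√a - √b| * (√a + √b)
        = (|√a - √b| - t * (√a + √b)) ^ 2 / (2 * t) := by
      field_simp
      ring
    have : 0 ≤ (|√a - √b| - t * (√a + √b)) ^ 2 / (2 * t) := by positivity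
    linarith
  rw [h1]
  nlinarith

theorem integral_comp_lsDensity (f : ℝ → ℝ) (η : ℝ) {s : ℝ} (hs : 0 < s)
    (g : ℝ → ℝ) : ∫ y, lsDensity f η s y * g y = ∫ u, f u * g (η + s * u) := by
  have h1 : ∫ y, lsDensity f η s y * g y = ∫ y, lsDensity f η s (η + y) * g (η + y) :=
    (integral_add_left_eq_self (fun y => lsDensity f η s y * g y) η).symm
  have h2 := Measure.integral_comp_mul_left
    (fun y => lsDensity f η s (η + y) * g (η + y)) s
  rw [h1]
  simp only [lsDensity_affine_self f η hs] at h2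
  rw [abs_of_pos (inv_pos.2 hs), smul_eq_mul] at h2
  have h3 : ∫ u, s⁻¹ * f u * g (η + s * u) = s⁻¹ * ∫ u, f u * g (η + s * u) := by
    rw [← integral_const_mul]
    simp only [mul_assoc]
  rw [h3] at h2
  exact (mul_left_cancel₀ (inv_pos.2 hs).ne' h2).symm

/-- Test functions bound the Hellinger distance from below. -/
theorem sq_div_four_le_integral_hellinger {g : ℝ → ℝ} (hf : IsDensity volume f)
    (hg : IsDensity volume g) {φ : ℝ → ℝ} (hφ : Measurable φ) (hφ1 : ∀ y, |φ y| ≤ 1) {δ : ℝ}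
    (hδ : 0 < δ) (h : δ ≤ |(∫ y, g y * φ y) - ∫ y, f y * φ y|) :
    δ ^ 2 / 4 ≤ ∫ y, (√(f y) - √(g y)) ^ 2 := by
  have hmul : ∀ {p : ℝ → ℝ}, IsDensity volume p → Integrable fun y => p y * φ y := fun hp =>
    hp.integrable.mul_bdd (c := 1) hφ.aestronglyMeasurable (Eventually.of_forall hφ1)
  have hI := integrable_hellinger hf hg
  set I := ∫ y, (√(f y) - √(g y)) ^ 2 with hIdef
  -- With weight δ/4 the term t(f + g) integrates to δ/2, half of the gap; the other half must come
  -- from the Hellinger integral.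
  have ht : 0 < δ / 4 := by positivity
  have h1 : |(∫ y, g y * φ y) - ∫ y, f y * φ y| ≤ I / (2 * (δ / 4)) + δ / 4 * (1 + 1) := by
    rw [← integral_sub (hmul hg) (hmul hf)]
    refine abs_integral_le_integral_abs.trans ?_
    have hR : Integrable (fun y => (√(f y) - √(g y)) ^ 2 / (2 * (δ / 4))
        + δ / 4 * (f y + g y)) :=
      (hI.div_const _).add ((hf.integrable.add hg.integrable).const_mul _)
    calc ∫ y, |g y * φ y - f y * φ y|
        ≤ ∫ y, ((√(f y) - √(g y)) ^ 2 / (2 * (δ / 4)) + δ / 4 * (f y + g y)) := by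
          refine integral_mono ((hmul hg).sub (hmul hf)).abs hR fun y => ?_
          simp only
          rw [← sub_mul, abs_mul, abs_sub_comm]
          calc |f y - g y| * |φ y| ≤ |f y - g y| * 1 := by gcongr; exact hφ1 y
            _ ≤ _ := by
              rw [mul_one]
              exact abs_sub_le_hellinger (hf.nonneg y) (hg.nonneg y) ht
      _ = I / (2 * (δ / 4)) + δ / 4 * (1 + 1) := by
          rw [integral_add (g := fun y => δ / 4 * (f y + g y)) (hI.div_const _)
            ((hf.integrable.add hg.integrable).const_mul _),
            integral_div, integral_const_mul, integral_add hf.integrable hg.integrable,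
            hf.integral_eq_one, hg.integral_eq_one]
  have h2 := h.trans h1
  have h3 : δ / 2 ≤ I / (2 * (δ / 4)) := by linarith
  rw [le_div_iff₀ (by positivity)] at h3
  linarith [sq δ]

theorem hellSq_eq_ofReal_integral (hf : IsDensity volume f) {θ : ℝ × ℝ} (hθ : 0 < θ.2) :
    hellSq f θ = ENNReal.ofReal (∫ y, (√(f y) - √(lsDensity f θ.1 θ.2 y)) ^ 2) :=
  (ofReal_integral_eq_lintegral_ofReal
    (integrable_hellinger hf (isDensity_lsDensity hf θ.1 hθ))
    (Eventually.of_forall fun _ => sq_nonneg _)).symm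

theorem eventually_snd_pos {θ₀ : ℝ × ℝ} (hpos : 0 < θ₀.2) : ∀ᶠ θ in 𝓝 θ₀, 0 < θ.2 :=
  continuous_snd.continuousAt.eventually_const_lt hpos

/-- By identifiability some bounded continuous function has different means under the law of f and
its image under θ₀. Dominated convergence makes this gap continuous in θ, so it persists nearby and
bounds the Hellinger distance below. -/
theorem exists_hellSq_ge_nhds (hf : IsDensity volume f) {θ₀ : ℝ × ℝ} (hpos : 0 < θ₀.2)
    (hne : θ₀ ≠ (0, 1)) :
    ∃ c : ℝ, 0 < c ∧ ∀ᶠ θ in 𝓝 θ₀, ENNReal.ofReal c ≤ hellSq f θ := by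
  have := hf.isProbabilityMeasure
  have : NullSingletonClass (densityMeasure volume f) := by
    unfold densityMeasure
    infer_instance
  have hmap := map_affine_ne (densityMeasure volume f) hpos (η := θ₀.1) hne
  have hTm : Measurable fun u : ℝ => θ₀.1 + θ₀.2 * u := by fun_prop
  have : IsProbabilityMeasure ((densityMeasure volume f).map fun u => θ₀.1 + θ₀.2 * u) :=
    Measure.isProbabilityMeasure_map hTm.aemeasurable
  obtain ⟨φ₀, hφ₀⟩ : ∃ φ₀ : BoundedContinuousFunction ℝ ℝ,
      ∫ u, f u * φ₀ (θ₀.1 + θ₀.2 * u) ≠ ∫ u, f u * φ₀ u := by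
    by_contra! hcon
    refine hmap (ext_of_forall_integral_eq_of_IsFiniteMeasure fun g => ?_)
    rw [integral_map hTm.aemeasurable g.continuous.aestronglyMeasurable,
      integral_densityMeasure hf, integral_densityMeasure hf, hcon]
  set φ : ℝ → ℝ := fun y => φ₀ y / (‖φ₀‖ + 1) with hφ
  have hφc : Continuous φ := φ₀.continuous.div_const _
  have hφ1 : ∀ y, |φ y| ≤ 1 := by
    intro y
    rw [hφ, abs_div, abs_of_pos (show 0 < ‖φ₀‖ + 1 by positivity), div_le_one (by positivity)]
    have := φ₀.norm_coe_le_norm y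
    rw [Real.norm_eq_abs] at this
    linarith
  set Δ : ℝ × ℝ → ℝ := fun θ => (∫ u, f u * φ (θ.1 + θ.2 * u)) - ∫ u, f u * φ u with hΔ
  have hfm := hf.measurable
  have hΔc : Continuous Δ := by
    refine Continuous.sub (continuous_of_dominated (bound := f) (fun θ => ?_) (fun θ => ?_)
      hf.integrable ?_) continuous_const
    · exact (hfm.mul (hφc.measurable.comp
        (show Measurable fun u : ℝ => θ.1 + θ.2 * u by fun_prop))).aestronglyMeasurable
    · refine Eventually.of_forall fun u => ?_
      rw [Real.norm_eq_abs, abs_mul, abs_of_nonneg (hf.nonneg u)]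
      exact mul_le_of_le_one_right (hf.nonneg u) (hφ1 _)
    · exact Eventually.of_forall fun u => continuous_const.mul (hφc.comp
        (show Continuous fun θ : ℝ × ℝ => θ.1 + θ.2 * u by fun_prop))
  have hΔ0 : Δ θ₀ ≠ 0 := by
    simp only [hΔ, hφ, ← mul_div_assoc]
    rw [integral_div, integral_div, ← sub_div]
    exact div_ne_zero (sub_ne_zero.2 hφ₀) (by positivity)
  have hδ : 0 < |Δ θ₀| / 2 := half_pos (abs_pos.2 hΔ0)
  refine ⟨(|Δ θ₀| / 2) ^ 2 / 4, by positivity, ?_⟩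
  filter_upwards [eventually_snd_pos hpos, hΔc.abs.continuousAt.eventually_const_lt
    (half_lt_self (abs_pos.2 hΔ0))] with θ h1 h2
  rw [hellSq_eq_ofReal_integral hf h1]
  refine ENNReal.ofReal_le_ofReal (sq_div_four_le_integral_hellinger hf
    (isDensity_lsDensity hf θ.1 h1) hφc.measurable hφ1 hδ ?_)
  rw [integral_comp_lsDensity f θ.1 h1]
  exact h2.le

theorem hellSq_eq_eLpNorm_sq (f : ℝ → ℝ) (θ : ℝ × ℝ) :
    hellSq f θ = eLpNorm (fun y => √(lsDensity f θ.1 θ.2 y) - √(lsDensity f 0 1 y)) 2 volume ^ 2 := by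
  have h := eLpNorm_nnreal_pow_eq_lintegral (μ := volume) (p := 2)
    (f := fun y => √(lsDensity f θ.1 θ.2 y) - √(lsDensity f 0 1 y)) two_ne_zero
  simp only [NNReal.coe_ofNat, ENNReal.coe_ofNat, ENNReal.rpow_ofNat] at h
  rw [h, hellSq, lsDensity_zero_one]
  refine lintegral_congr fun y => ?_
  rw [← ofReal_norm, ← ENNReal.ofReal_pow (norm_nonneg _), Real.norm_eq_abs, sq_abs,
    ← neg_sq, neg_sub]

/-- Linear independence says that (a, b) ↦ a ξ₁ + b ξ₂ is injective into L², and an injective linear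
map on a finite-dimensional space is bounded below. -/
theorem exists_norm_le_eLpNorm {ξ₁ ξ₂ : ℝ → ℝ} (h₁ : MemLp ξ₁ 2 volume) (h₂ : MemLp ξ₂ 2 volume)
    (hind : ∀ a b : ℝ, (∀ᵐ y ∂volume, a * ξ₁ y + b * ξ₂ y = 0) → a = 0 ∧ b = 0) :
    ∃ K : ℝ, 0 < K ∧ ∀ a b : ℝ,
      √(a ^ 2 + b ^ 2) ≤ K * (eLpNorm (fun y => a * ξ₁ y + b * ξ₂ y) 2 volume).toReal := by
  have : Fact ((1 : ENNReal) ≤ 2) := ⟨one_le_two⟩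
  let T : ℝ × ℝ →ₗ[ℝ] Lp ℝ 2 (volume : Measure ℝ) :=
    (LinearMap.fst ℝ ℝ ℝ).smulRight (h₁.toLp ξ₁) + (LinearMap.snd ℝ ℝ ℝ).smulRight (h₂.toLp ξ₂)
  have hmem : ∀ a b : ℝ, MemLp (fun y => a * ξ₁ y + b * ξ₂ y) 2 volume := fun a b =>
    (h₁.const_mul a).add (h₂.const_mul b)
  have hT : ∀ a b : ℝ, T (a, b) = (hmem a b).toLp _ := fun a b => rfl
  have hker : LinearMap.ker T = ⊥ := by
    rw [LinearMap.ker_eq_bot']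
    rintro ⟨a, b⟩ h0
    rw [hT] at h0
    have h3 : (fun y => a * ξ₁ y + b * ξ₂ y) =ᵐ[volume] 0 := 
      (hmem a b).coeFn_toLp.symm.trans (Lp.eq_zero_iff_ae_eq_zero.1 h0)
    obtain ⟨ha, hb⟩ := hind a b h3
    rw [ha, hb]
    rfl
  obtain ⟨K, hK, hanti⟩ := T.exists_antilipschitzWith hker
  refine ⟨2 * K, by positivity, fun a b => ?_⟩
  have h4 := hanti.le_mul_dist (a, b) 0
  rw [map_zero, dist_zero_right, dist_zero_right, hT, Lp.norm_toLp] at h4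
  have ha : |a| ≤ ‖(a, b)‖ := norm_fst_le (a, b)
  have hb : |b| ≤ ‖(a, b)‖ := norm_snd_le (a, b)
  have h5 : √(a ^ 2 + b ^ 2) ≤ 2 * ‖(a, b)‖ := by
    rw [Real.sqrt_le_left (by positivity), ← sq_abs a, ← sq_abs b]
    nlinarith [abs_nonneg a, abs_nonneg b]
  linarith

theorem exists_hellSq_ge_nhds_one (hf : IsDensity volume f) (hH : HellingerNondegenerate f) :
    ∃ c : ℝ, 0 < c ∧ ∀ᶠ θ in 𝓝 ((0 : ℝ), (1 : ℝ)), ENNReal.ofReal (c * paramSq θ) ≤ hellSq f θ := by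
  obtain ⟨ξ₁, ξ₂, ⟨h₁, h₂, ho⟩, hind⟩ := hH
  obtain ⟨K, hK, hKle⟩ := exists_norm_le_eLpNorm h₁ h₂ hind
  -- The linear part has norm at least r/K, and the remainder is eventually at most r/(2K), so
  -- r/(2K) survives the triangle inequality.
  refine ⟨(1 / (2 * K)) ^ 2, by positivity, ?_⟩
  filter_upwards [ho.def (show 0 < 1 / (2 * K) by positivity),
    eventually_snd_pos (show (0 : ℝ) < ((0 : ℝ), (1 : ℝ)).2 from one_pos)] with θ hθ hpos
  set G : ℝ → ℝ := fun y => √(lsDensity f θ.1 θ.2 y) - √(lsDensity f 0 1 y) with hG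
  set T : ℝ → ℝ := fun y => θ.1 * ξ₁ y + (θ.2 - 1) * ξ₂ y with hT
  set r := √(θ.1 ^ 2 + (θ.2 - 1) ^ 2) with hr
  have hr0 : 0 ≤ r := Real.sqrt_nonneg _
  have hTmem : MemLp T 2 volume := (h₁.const_mul _).add (h₂.const_mul _)
  have hGmem : MemLp G 2 volume := by
    have hm1 := measurable_lsDensity hf.measurable θ.1 θ.2
    have hm2 := measurable_lsDensity hf.measurable 0 1
    rw [memLp_two_iff_integrable_sq (Measurable.aestronglyMeasurable (by fun_prop))]
    exact integrable_hellinger (isDensity_lsDensity hf θ.1 hpos) (isDensity_lsDensity hf 0 one_pos)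
  have htri : (eLpNorm T 2 volume).toReal
      ≤ (eLpNorm G 2 volume).toReal + (eLpNorm (fun y => G y - T y) 2 volume).toReal := by
    have e : T = G - (fun y => G y - T y) := by funext y; simp
    have hd : eLpNorm (fun y => G y - T y) 2 volume ≠ ⊤ := (hGmem.sub hTmem).eLpNorm_ne_top
    rw [← ENNReal.toReal_add hGmem.eLpNorm_ne_top hd]
    refine ENNReal.toReal_mono (ENNReal.add_ne_top.2 ⟨hGmem.eLpNorm_ne_top, hd⟩) ?_
    conv_lhs => rw [e]
    exact eLpNorm_sub_le hGmem.aestronglyMeasurable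
      (hGmem.sub hTmem).aestronglyMeasurable one_le_two
  rw [Real.norm_of_nonneg ENNReal.toReal_nonneg, Real.norm_of_nonneg hr0] at hθ
  have hlow := hKle θ.1 (θ.2 - 1)
  have h6 : 1 / (2 * K) * r ≤ (eLpNorm G 2 volume).toReal := by
    have h7 : r / K ≤ (eLpNorm T 2 volume).toReal := by
      rw [div_le_iff₀ hK, mul_comm]
      exact hlow
    have e : r / K = 1 / (2 * K) * r + 1 / (2 * K) * r := by
      field_simp
      ring
    linarith
  rw [hellSq_eq_eLpNorm_sq, ← ENNReal.ofReal_toReal hGmem.eLpNorm_ne_top,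
    ← ENNReal.ofReal_pow ENNReal.toReal_nonneg]
  refine ENNReal.ofReal_le_ofReal ?_
  have e : paramSq θ = r ^ 2 := by
    rw [hr, Real.sq_sqrt (by positivity), paramSq]
    ring
  rw [e, ← mul_pow]
  exact pow_le_pow_left₀ (by positivity) h6 2

theorem exists_le_hellSq_of_isCompact (hf : IsDensity volume f) (hH : HellingerNondegenerate f)
    {B : Set (ℝ × ℝ)} (hB : IsCompact B) (hBpos : ∀ θ ∈ B, 0 < θ.2) :
    ∃ k : ℝ, 0 < k ∧ ∀ θ ∈ B, ENNReal.ofReal (k * paramSq θ) ≤ hellSq f θ := by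
  refine hB.induction_on (p := fun s => ∃ k : ℝ, 0 < k ∧ ∀ θ ∈ s,
    ENNReal.ofReal (k * paramSq θ) ≤ hellSq f θ) ⟨1, one_pos, by simp⟩ ?_ ?_ ?_
  · rintro s t hst ⟨K, hK, h⟩
    exact ⟨K, hK, fun θ hθ => h θ (hst hθ)⟩
  · rintro s t ⟨K, hK, h⟩ ⟨L, hL, h'⟩
    refine ⟨min K L, by positivity, ?_⟩
    rintro θ (hθ | hθ)
    · refine (ENNReal.ofReal_le_ofReal ?_).trans (h θ hθ)
      exact mul_le_mul_of_nonneg_right (min_le_left _ _) (paramSq_nonneg θ)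
    · refine (ENNReal.ofReal_le_ofReal ?_).trans (h' θ hθ)
      exact mul_le_mul_of_nonneg_right (min_le_right _ _) (paramSq_nonneg θ)
  · intro θ₀ hθ₀
    suffices h : ∃ k : ℝ, 0 < k ∧ ∀ᶠ θ in 𝓝 θ₀, ENNReal.ofReal (k * paramSq θ) ≤ hellSq f θ by
      obtain ⟨K, hK, h⟩ := h
      exact ⟨_, mem_nhdsWithin_of_mem_nhds h, K, hK, fun θ hθ => hθ⟩
    by_cases h0 : θ₀ = (0, 1)
    · rw [h0]
      exact exists_hellSq_ge_nhds_one hf hH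
    · obtain ⟨c, hc, h⟩ := exists_hellSq_ge_nhds hf (hBpos θ₀ hθ₀) h0
      have hr := paramSq_nonneg θ₀
      refine ⟨c / (paramSq θ₀ + 1), by positivity, ?_⟩
      filter_upwards [h,
        continuous_paramSq.continuousAt.eventually_lt_const (lt_add_one _)] with θ h1 h2
      refine (ENNReal.ofReal_le_ofReal ?_).trans h1
      rw [div_mul_eq_mul_div, div_le_iff₀ (by positivity)]
      gcongr

end Hellinger

/-! ### Uniform comparison over the parameter box -/

section UniformFamily

variable {f : ℝ → ℝ} {J σbar : ℝ}

/-- The parameters of the family allowed by the bounds on the regression and scale functions. -/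
def paramBox (J σbar : ℝ) : Set (ℝ × ℝ) :=
  Set.Icc (-J) J ×ˢ Set.Icc σbar⁻¹ σbar

theorem snd_pos_of_mem_paramBox (hσ : 1 < σbar) {θ : ℝ × ℝ} (h : θ ∈ paramBox J σbar) :
    0 < θ.2 :=
  lt_of_lt_of_le (inv_pos.2 (by linarith)) h.2.1

/-- The parameter of `θ'` relative to `θ`. -/
noncomputable def relParam (θ θ' : ℝ × ℝ) : ℝ × ℝ := ((θ'.1 - θ.1) / θ.2, θ'.2 / θ.2)

theorem isCompact_relParam_image (hσ : 1 < σbar) :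
    IsCompact ((fun z : (ℝ × ℝ) × ℝ × ℝ => relParam z.1 z.2) ''
      (paramBox J σbar ×ˢ paramBox J σbar)) := by
  have hc : IsCompact (paramBox J σbar) := isCompact_Icc.prod isCompact_Icc
  refine (hc.prod hc).image_of_continuousOn ?_
  have h0 : ∀ z ∈ paramBox J σbar ×ˢ paramBox J σbar, z.1.2 ≠ 0 := fun z hz =>
    (snd_pos_of_mem_paramBox hσ hz.1).ne'
  unfold relParam
  exact ContinuousOn.prodMk (ContinuousOn.div (by fun_prop) (by fun_prop) h0)
    (ContinuousOn.div (by fun_prop) (by fun_prop) h0)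

theorem paramSq_relParam {θ : ℝ × ℝ} (h : 0 < θ.2) (θ' : ℝ × ℝ) :
    paramSq (relParam θ θ') = ((θ.1 - θ'.1) ^ 2 + (θ.2 - θ'.2) ^ 2) / θ.2 ^ 2 := by
  unfold paramSq relParam
  field_simp
  ring

theorem relParam_pos (hσ : 1 < σbar) : ∀ θ ∈ (fun z : (ℝ × ℝ) × ℝ × ℝ => relParam z.1 z.2) ''
    (paramBox J σbar ×ˢ paramBox J σbar), 0 < θ.2 := by
  rintro _ ⟨z, hz, rfl⟩
  exact div_pos (snd_pos_of_mem_paramBox hσ hz.2) (snd_pos_of_mem_paramBox hσ hz.1)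

theorem exists_lintegral_klTerm_le (hf : IsDensity volume f) (hKL : KLFiniteContinuous f)
    (hloc : KLLocallyQuadratic f) (J : ℝ) (hσ : 1 < σbar) :
    ∃ K : ℝ, 0 < K ∧ ∀ θ ∈ paramBox J σbar, ∀ θ' ∈ paramBox J σbar,
      ∫⁻ y, klTerm (lsDensity f θ.1 θ.2 y) (lsDensity f θ'.1 θ'.2 y)
        ≤ ENNReal.ofReal (K * ((θ.1 - θ'.1) ^ 2 + (θ.2 - θ'.2) ^ 2)) := by
  obtain ⟨K, hK, h⟩ := exists_lsKL_le_of_isCompact hKL hloc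
    (isCompact_relParam_image (J := J) hσ) (relParam_pos hσ)
  -- The relative parameter divides the squared gaps by θ.2², which is at least σbar⁻².
  refine ⟨K * σbar ^ 2, by positivity, fun θ hθ θ' hθ' => ?_⟩
  have hp := snd_pos_of_mem_paramBox hσ hθ
  have hp' := snd_pos_of_mem_paramBox hσ hθ'
  have hr : 0 < (relParam θ θ').2 := div_pos hp' hp
  have h1 := h (relParam θ θ') ⟨(θ, θ'), ⟨hθ, hθ'⟩, rfl⟩
  have h2 := lintegral_klTerm_eq_klDiv hf (isDensity_lsDensity hf (relParam θ θ').1 hr)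
    (by simpa [lsKL, lsDensity_zero_one] using (hKL.1 (relParam θ θ') hr).ne)
  rw [lintegral_klTerm_lsDensity hf _ _ hp hp']
  refine (h2.trans_le ?_).trans (h1.trans (ENNReal.ofReal_le_ofReal ?_))
  · rw [lsKL, lsDensity_zero_one]
  · rw [paramSq_relParam hp, mul_assoc]
    gcongr
    rw [div_le_iff₀ (by positivity)]
    have h3 : 1 ≤ σbar ^ 2 * θ.2 ^ 2 := by
      have h4 : 1 ≤ σbar * θ.2 := by
        have := mul_le_mul_of_nonneg_left hθ.2.1 (show 0 ≤ σbar by linarith)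
        rwa [mul_inv_cancel₀ (by linarith)] at this
      rw [← mul_pow]
      exact one_le_pow₀ h4
    nlinarith [sq_nonneg (θ.1 - θ'.1), sq_nonneg (θ.2 - θ'.2)]

theorem exists_le_lintegral_hellinger (hf : IsDensity volume f) (hH : HellingerNondegenerate f)
    (J : ℝ) (hσ : 1 < σbar) :
    ∃ k : ℝ, 0 < k ∧ ∀ θ ∈ paramBox J σbar, ∀ θ' ∈ paramBox J σbar,
      ENNReal.ofReal (k * (θ.1 - θ'.1) ^ 2)
        ≤ ∫⁻ y, ENNReal.ofReal ((√(lsDensity f θ.1 θ.2 y) - √(lsDensity f θ'.1 θ'.2 y)) ^ 2) := by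
  obtain ⟨k, hk, h⟩ := exists_le_hellSq_of_isCompact hf hH
    (isCompact_relParam_image (J := J) hσ) (relParam_pos hσ)
  -- Here θ.2 ≤ σbar is used, and the scale gap is dropped: only the regression function is to be
  -- estimated.
  refine ⟨k / σbar ^ 2, by positivity, fun θ hθ θ' hθ' => ?_⟩
  have hp := snd_pos_of_mem_paramBox hσ hθ
  have hp' := snd_pos_of_mem_paramBox hσ hθ'
  rw [lintegral_hellinger_lsDensity hf _ _ hp hp']
  refine (ENNReal.ofReal_le_ofReal ?_).trans (h (relParam θ θ') ⟨(θ, θ'), ⟨hθ, hθ'⟩, rfl⟩)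
  rw [paramSq_relParam hp, div_mul_eq_mul_div, mul_div_assoc]
  gcongr
  · nlinarith [sq_nonneg (θ.2 - θ'.2)]
  · exact hθ.2.2

end UniformFamily

/-! ### The regression model and integrated comparisons -/

section Model

variable {𝒳 : Type*} [MeasurableSpace 𝒳] {ν : Measure 𝒳} {f : ℝ → ℝ} {h u v w : 𝒳 → ℝ}

theorem sqDist_self : sqDist ν h u u = 0 := by simp [sqDist]

theorem sqDist_comm : sqDist ν h u v = sqDist ν h v u := by
  unfold sqDist
  refine lintegral_congr fun x => ?_
  rw [← neg_sub, neg_sq]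

theorem sqDist_eq_lintegral (hh : IsDensity ν h) (hu : Measurable u) (hv : Measurable v) :
    sqDist ν h u v = ∫⁻ x, ENNReal.ofReal ((u x - v x) ^ 2) ∂densityMeasure ν h := by
  rw [lintegral_densityMeasure hh.measurable (by fun_prop), sqDist]
  refine lintegral_congr fun x => ?_
  rw [mul_comm, ENNReal.ofReal_mul (hh.nonneg x)]

theorem sqDist_le_add (hh : IsDensity ν h) (hu : Measurable u) (hv : Measurable v)
    (hw : Measurable w) : sqDist ν h u v ≤ 2 * (sqDist ν h u w + sqDist ν h w v) := by
  have hhm := hh.measurable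
  unfold sqDist
  rw [← lintegral_add_left (by fun_prop), ← lintegral_const_mul _ (by fun_prop)]
  refine lintegral_mono fun x => ?_
  have h0 := hh.nonneg x
  rw [← ENNReal.ofReal_add (by positivity) (by positivity),
    show (2 : ENNReal) = ENNReal.ofReal 2 by simp, ← ENNReal.ofReal_mul zero_le_two]
  refine ENNReal.ofReal_le_ofReal ?_
  rw [← add_mul, ← mul_assoc]
  refine mul_le_mul_of_nonneg_right ?_ h0
  nlinarith [sq_nonneg ((u x - w x) - (w x - v x))]

theorem sqDist_le_mul {h₀ : 𝒳 → ℝ} {C : ℝ} (hh₀ : IsDensity ν h₀) (hu : Measurable u)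
    (hv : Measurable v) (hle : ∀ x, h x ≤ C * h₀ x) :
    sqDist ν h u v ≤ ENNReal.ofReal C * sqDist ν h₀ u v := by
  have hhm := hh₀.measurable
  unfold sqDist
  rw [← lintegral_const_mul _ (by fun_prop)]
  refine lintegral_mono fun x => ?_
  have h0 := hh₀.nonneg x
  rw [← ENNReal.ofReal_mul' (by positivity)]
  refine ENNReal.ofReal_le_ofReal ?_
  nlinarith [mul_le_mul_of_nonneg_left (hle x) (sq_nonneg (u x - v x))]

theorem measurable_sqDist_est {Z : Type*} [MeasurableSpace Z] {est : Z → 𝒳 → ℝ} [SFinite ν]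
    (hh : Measurable h) (hu : Measurable u) (hest : Measurable (Function.uncurry est)) :
    Measurable fun z => sqDist ν h u (est z) := by
  unfold sqDist
  refine Measurable.lintegral_prod_right'
    (f := fun z : Z × 𝒳 => ENNReal.ofReal ((u z.2 - est z.1 z.2) ^ 2 * h z.2)) ?_
  have : Measurable fun z : Z × 𝒳 => est z.1 z.2 := hest
  fun_prop

/-- The conditional density of the response given the covariate. -/
noncomputable def condDensity (f : ℝ → ℝ) (μ σ : 𝒳 → ℝ) (z : 𝒳 × ℝ) : ℝ :=
  lsDensity f (μ z.1) (σ z.1) z.2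

/-- The reference measure for one observation when the design density is `h`. -/
noncomputable def baseMeasure (ν : Measure 𝒳) (h : 𝒳 → ℝ) : Measure (𝒳 × ℝ) :=
  (densityMeasure ν h).prod volume

theorem measurable_condDensity (hf : Measurable f) {μ σ : 𝒳 → ℝ} (hμ : Measurable μ)
    (hσ : Measurable σ) : Measurable (condDensity f μ σ) := by
  unfold condDensity lsDensity
  fun_prop

theorem isDensity_condDensity (hf : IsDensity volume f) {μ σ : 𝒳 → ℝ} (hμ : Measurable μ)
    (hσ : Measurable σ) (hσ0 : ∀ x, 0 < σ x) (hh : IsDensity ν h) :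
    IsDensity (baseMeasure ν h) (condDensity f μ σ) := by
  have := hh.isProbabilityMeasure
  have hm := measurable_condDensity hf.measurable hμ hσ
  refine ⟨hm, fun z => lsDensity_nonneg hf.nonneg (hσ0 _) _ _, ?_⟩
  rw [baseMeasure, lintegral_prod _ hm.ennreal_ofReal.aemeasurable]
  simp only [condDensity, (isDensity_lsDensity hf _ (hσ0 _)).lintegral_eq_one]
  simp

/-- With the design law absorbed into the reference measure, the density of an observation does not
involve h; likelihoods can therefore be maximized without knowing the design. -/
theorem obsLaw_eq (hf : IsDensity volume f) {μ σ : 𝒳 → ℝ} (hμ : Measurable μ)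
    (hσ : Measurable σ) (hσ0 : ∀ x, 0 < σ x) (hh : IsDensity ν h) :
    obsLaw ν f μ σ h = densityMeasure (baseMeasure ν h) (condDensity f μ σ) := by
  have := hh.isProbabilityMeasure
  have := hf.isProbabilityMeasure
  have hfm := hf.measurable
  have hm := measurable_condDensity hf.measurable hμ hσ
  have hT : Measurable fun z : 𝒳 × ℝ => (z.1, μ z.1 + σ z.1 * z.2) := by fun_prop
  refine Measure.ext_of_lintegral _ fun F hF => ?_
  have hFT : Measurable fun z : 𝒳 × ℝ => F (z.1, μ z.1 + σ z.1 * z.2) := hF.comp hT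
  rw [obsLaw, lintegral_map hF hT, lintegral_densityMeasure hm hF, baseMeasure,
    lintegral_prod _ hFT.aemeasurable,
    lintegral_prod (fun z => ENNReal.ofReal (condDensity f μ σ z) * F z)
      (hm.ennreal_ofReal.mul hF).aemeasurable]
  refine lintegral_congr fun x => ?_
  have hFx : Measurable fun y => F (x, y) := hF.comp measurable_prodMk_left
  have hmx : Measurable fun y => lsDensity f (μ x) (σ x) y :=
    measurable_lsDensity hfm _ _
  have hFx' : Measurable fun u => F (x, μ x + σ x * u) :=
    hFx.comp (show Measurable fun u : ℝ => μ x + σ x * u by fun_prop)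
  rw [lintegral_densityMeasure hfm hFx']
  simp only [condDensity]
  rw [lintegral_comp_affine (hσ0 x) (μ x) 
    (g := fun y => ENNReal.ofReal (lsDensity f (μ x) (σ x) y) * F (x, y))
    (hmx.ennreal_ofReal.mul hFx)]
  simp only [lsDensity_affine_self f (μ x) (hσ0 x),
    ENNReal.ofReal_mul (inv_nonneg.2 (hσ0 x).le), mul_assoc]
  rw [lintegral_const_mul (f := fun u => ENNReal.ofReal (f u) * F (x, μ x + σ x * u)) _
    (hfm.ennreal_ofReal.mul hFx'), ← mul_assoc,
    ← ENNReal.ofReal_mul (hσ0 x).le, mul_inv_cancel₀ (hσ0 x).ne', ENNReal.ofReal_one, one_mul]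

theorem lintegral_klTerm_condDensity_le (hf : IsDensity volume f) (hh : IsDensity ν h)
    {B : Set (ℝ × ℝ)} {K : ℝ} (hK : 0 < K)
    (hKle : ∀ θ ∈ B, ∀ θ' ∈ B,
      ∫⁻ y, klTerm (lsDensity f θ.1 θ.2 y) (lsDensity f θ'.1 θ'.2 y)
        ≤ ENNReal.ofReal (K * ((θ.1 - θ'.1) ^ 2 + (θ.2 - θ'.2) ^ 2)))
    {μ σ μ' σ' : 𝒳 → ℝ} (hμ : Measurable μ) (hσ : Measurable σ) (hμ' : Measurable μ')
    (hσ' : Measurable σ') (hB : ∀ x, (μ x, σ x) ∈ B) (hB' : ∀ x, (μ' x, σ' x) ∈ B) :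
    ∫⁻ z, klTerm (condDensity f μ σ z) (condDensity f μ' σ' z) ∂baseMeasure ν h
      ≤ ENNReal.ofReal K * (sqDist ν h μ μ' + sqDist ν h σ σ') := by
  have hm := measurable_condDensity hf.measurable hμ hσ
  have hm' := measurable_condDensity hf.measurable hμ' hσ'
  rw [baseMeasure, lintegral_prod _ (Measurable.klTerm hm hm').aemeasurable,
    sqDist_eq_lintegral hh hμ hμ', sqDist_eq_lintegral hh hσ hσ',
    ← lintegral_add_left (by fun_prop), ← lintegral_const_mul _ (by fun_prop)]
  refine lintegral_mono fun x => ?_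
  rw [← ENNReal.ofReal_add (sq_nonneg _) (sq_nonneg _), ← ENNReal.ofReal_mul hK.le]
  exact hKle _ (hB x) _ (hB' x)

theorem le_lintegral_hellinger_condDensity (hf : IsDensity volume f) (hh : IsDensity ν h)
    {B : Set (ℝ × ℝ)} {k : ℝ} (hk : 0 < k)
    (hkle : ∀ θ ∈ B, ∀ θ' ∈ B, ENNReal.ofReal (k * (θ.1 - θ'.1) ^ 2)
        ≤ ∫⁻ y, ENNReal.ofReal ((√(lsDensity f θ.1 θ.2 y) - √(lsDensity f θ'.1 θ'.2 y)) ^ 2))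
    {μ σ μ' σ' : 𝒳 → ℝ} (hμ : Measurable μ) (hσ : Measurable σ) (hμ' : Measurable μ')
    (hσ' : Measurable σ') (hB : ∀ x, (μ x, σ x) ∈ B) (hB' : ∀ x, (μ' x, σ' x) ∈ B) :
    ENNReal.ofReal k * sqDist ν h μ μ'
      ≤ ∫⁻ z, ENNReal.ofReal ((√(condDensity f μ σ z) - √(condDensity f μ' σ' z)) ^ 2)
          ∂baseMeasure ν h := by
  have hm := measurable_condDensity hf.measurable hμ hσ
  have hm' := measurable_condDensity hf.measurable hμ' hσ'
  rw [baseMeasure, lintegral_prod _ (Measurable.aemeasurable (by fun_prop)),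
    sqDist_eq_lintegral hh hμ hμ', ← lintegral_const_mul _ (by fun_prop)]
  refine lintegral_mono fun x => ?_
  rw [← ENNReal.ofReal_mul hk.le]
  exact hkle _ (hB x) _ (hB' x)

end Model

/-! ### Coverings, packings and measurable selection -/

section Nets

variable {𝒳 : Type*} [MeasurableSpace 𝒳] {ν : Measure 𝒳} {h : 𝒳 → ℝ} {V : Set (𝒳 → ℝ)}

theorem log_card_le_of_isPacking {ε L : ℝ} (hL : 0 ≤ L)
    (hle : packingEntropy ν h V ε ≤ ENNReal.ofReal L) {N : Finset (𝒳 → ℝ)}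
    (hN : IsPacking ν h V ε N) : Real.log N.card ≤ L := by
  have h1 : ENNReal.ofReal (Real.log N.card) ≤ ENNReal.ofReal L :=
    (le_iSup₂ (f := fun (N : Finset (𝒳 → ℝ)) (_ : IsPacking ν h V ε N) =>
      ENNReal.ofReal (Real.log N.card)) N hN).trans hle
  exact (ENNReal.ofReal_le_ofReal_iff hL).1 h1

/-- A maximal packing set is a covering set. -/
theorem exists_covering {ε L : ℝ} (hL : 0 ≤ L)
    (hle : packingEntropy ν h V ε ≤ ENNReal.ofReal L) :
    ∃ N : Finset (𝒳 → ℝ), (∀ u ∈ N, u ∈ V) ∧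
      (∀ u ∈ V, ∃ v ∈ N, sqDist ν h u v ≤ ENNReal.ofReal (ε ^ 2)) ∧ Real.log N.card ≤ L := by
  classical
  set A : Set ℕ := {k | ∃ N, IsPacking ν h V ε N ∧ N.card = k} with hA
  have hne : A.Nonempty := ⟨0, ∅, ⟨by simp, by simp⟩, rfl⟩
  have hbdd : BddAbove A := by
    refine ⟨⌊Real.exp L⌋₊, ?_⟩
    rintro _ ⟨N, hN, rfl⟩
    refine Nat.le_floor ?_
    -- The empty packing is treated apart because `Real.log 0 = 0`.
    rcases Nat.eq_zero_or_pos N.card with h0 | h0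
    · rw [h0, Nat.cast_zero]
      exact (Real.exp_pos L).le
    · exact (Real.log_le_iff_le_exp (by exact_mod_cast h0)).1 (log_card_le_of_isPacking hL hle hN)
  obtain ⟨N, hN, hcard⟩ := Nat.sSup_mem hne hbdd
  refine ⟨N, hN.1, fun u hu => ?_, log_card_le_of_isPacking hL hle hN⟩
  by_contra! hcon
  have hnot : u ∉ N := fun hmem => by
    have := hcon u hmem
    rw [sqDist_self] at this
    exact not_lt_zero this
  have hins : IsPacking ν h V ε (insert u N) := by
    refine ⟨fun w hw => ?_, fun w hw w' hw' hne => ?_⟩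
    · rcases Finset.mem_insert.1 hw with rfl | hw
      · exact hu
      · exact hN.1 w hw
    · rcases Finset.mem_insert.1 hw with rfl | hwN <;>
        rcases Finset.mem_insert.1 hw' with rfl | hwN'
      · exact absurd rfl hne
      · exact hcon _ hwN'
      · rw [sqDist_comm]
        exact hcon _ hwN
      · exact hN.2 w hwN w' hwN' hne
  have hle' : (insert u N).card ≤ sSup A := le_csSup hbdd ⟨_, hins, rfl⟩
  rw [Finset.card_insert_of_notMem hnot, hcard] at hle'
  omega

theorem exists_packing_of_lt {ε L : ℝ} (hL : 0 ≤ L)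
    (hlt : ENNReal.ofReal L < packingEntropy ν h V ε) :
    ∃ N : Finset (𝒳 → ℝ), IsPacking ν h V ε N ∧ L < Real.log N.card := by
  rw [packingEntropy, lt_iSup_iff] at hlt
  obtain ⟨N, hN⟩ := hlt
  obtain ⟨hpack, hN⟩ := lt_iSup_iff.1 hN
  exact ⟨N, hpack, (ENNReal.ofReal_lt_ofReal_iff_of_nonneg hL).1 hN⟩

/-- A maximizer over a finite index set can be selected measurably. -/
theorem exists_measurable_argmax {ι Z : Type*} [MeasurableSpace Z] {s : Finset ι}
    (hs : s.Nonempty) {ℓ : ι → Z → ℝ} (hℓ : ∀ i, Measurable (ℓ i)) :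
    ∃ j : Z → ι, (∀ z, j z ∈ s) ∧ (∀ z, ∀ i ∈ s, ℓ i z ≤ ℓ (j z) z) ∧
      Measurable (fun z => ℓ (j z) z) ∧ ∀ {W : Type*} [MeasurableSpace W] (g : ι → W → ℝ),
        (∀ i ∈ s, Measurable (g i)) → Measurable fun w : Z × W => g (j w.1) w.2 := by
  classical
  -- No σ-algebra is put on the index type: measurability of the selection is expressed through
  -- composites. The attained maximum must be measurable so that its comparison with a new candidate
  -- defines a measurable set.
  induction hs using Finset.Nonempty.cons_induction with
  | singleton a =>
    refine ⟨fun _ => a, by simp, by simp, hℓ a, fun g hg => ?_⟩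
    exact (hg a (by simp)).comp measurable_snd
  | cons a s ha hs ih =>
    obtain ⟨j, hj, hmax, hjm, hjg⟩ := ih
    have hset : MeasurableSet {z | ℓ (j z) z ≤ ℓ a z} := measurableSet_le hjm (hℓ a)
    refine ⟨fun z => if ℓ (j z) z ≤ ℓ a z then a else j z, fun z => ?_, fun z i hi => ?_, ?_,
      fun g hg => ?_⟩
    · beta_reduce
      split_ifs
      · simp
      · exact Finset.mem_cons_of_mem (hj z)
    · beta_reduce
      rcases Finset.mem_cons.1 hi with rfl | hi
      · split_ifs with h1
        · exact le_rfl
        · exact (not_le.1 h1).le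
      · split_ifs with h1
        · exact (hmax z i hi).trans h1
        · exact hmax z i hi
    · have e : (fun z => ℓ (if ℓ (j z) z ≤ ℓ a z then a else j z) z)
          = fun z => if ℓ (j z) z ≤ ℓ a z then ℓ a z else ℓ (j z) z := by
        funext z
        split_ifs <;> rfl
      rw [e]
      exact Measurable.ite hset (hℓ a) hjm
    · have e : (fun w : Z × _ => g (if ℓ (j w.1) w.1 ≤ ℓ a w.1 then a else j w.1) w.2)
          = fun w => if ℓ (j w.1) w.1 ≤ ℓ a w.1 then g a w.2 else g (j w.1) w.2 := by
        funext w
        split_ifs <;> rfl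
      rw [e]
      refine Measurable.ite (measurable_fst hset)
        ((hg a (by simp)).comp measurable_snd) (hjg g fun i hi => hg i (by simp [hi]))

end Nets

/-! ### Risk bounds from finite nets -/

section Bounds

variable {𝒳 : Type*} [MeasurableSpace 𝒳] {ν : Measure 𝒳} {f : ℝ → ℝ} {U S H : Set (𝒳 → ℝ)}
  {B : Set (ℝ × ℝ)}

theorem sigmaFinite_baseMeasure {h : 𝒳 → ℝ} (hh : IsDensity ν h) :
    SigmaFinite (baseMeasure ν h) := by
  have := hh.isProbabilityMeasure
  unfold baseMeasure
  infer_instance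

/-- The risk of the maximum likelihood estimator over finite covering sets of `U` and `S`. -/
theorem minimaxRisk_le_of_covering (hf : IsDensity volume f)
    (hUm : ∀ μ ∈ U, Measurable μ) (hSm : ∀ σ ∈ S, Measurable σ) (hH : ∀ h ∈ H, IsDensity ν h)
    (hBpos : ∀ θ ∈ B, 0 < θ.2) (hB : ∀ μ ∈ U, ∀ σ ∈ S, ∀ x, (μ x, σ x) ∈ B)
    {K k : ℝ} (hK : 0 < K) (hk : 0 < k)
    (hKle : ∀ θ ∈ B, ∀ θ' ∈ B,
      ∫⁻ y, klTerm (lsDensity f θ.1 θ.2 y) (lsDensity f θ'.1 θ'.2 y)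
        ≤ ENNReal.ofReal (K * ((θ.1 - θ'.1) ^ 2 + (θ.2 - θ'.2) ^ 2)))
    (hkle : ∀ θ ∈ B, ∀ θ' ∈ B, ENNReal.ofReal (k * (θ.1 - θ'.1) ^ 2)
        ≤ ∫⁻ y, ENNReal.ofReal ((√(lsDensity f θ.1 θ.2 y) - √(lsDensity f θ'.1 θ'.2 y)) ^ 2))
    {h₀ : 𝒳 → ℝ} (hh₀ : h₀ ∈ H) {C : ℝ} (hC : 0 ≤ C) (hdom : ∀ h ∈ H, ∀ x, h x ≤ C * h₀ x)
    (hUne : U.Nonempty) (hSne : S.Nonempty)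
    {NU NS : Finset (𝒳 → ℝ)} {e : ℝ} (hNU : ∀ u ∈ NU, u ∈ U) (hNS : ∀ u ∈ NS, u ∈ S)
    (hcovU : ∀ u ∈ U, ∃ v ∈ NU, sqDist ν h₀ u v ≤ ENNReal.ofReal (e ^ 2))
    (hcovS : ∀ u ∈ S, ∃ v ∈ NS, sqDist ν h₀ u v ≤ ENNReal.ofReal (e ^ 2))
    {n : ℕ} (hn : 0 < n) :
    minimaxRisk ν f U S H n ≤ ENNReal.ofReal
      (2 / (n * k) * (Real.log NU.card + Real.log NS.card + n * (K * (C * (2 * e ^ 2))) / 2)) := by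
  classical
  let ι := ↥(NU ×ˢ NS)
  have hnetU : NU.Nonempty := by
    obtain ⟨u, hu⟩ := hUne
    obtain ⟨v, hv, -⟩ := hcovU u hu
    exact ⟨v, hv⟩
  have hnetS : NS.Nonempty := by
    obtain ⟨u, hu⟩ := hSne
    obtain ⟨v, hv, -⟩ := hcovS u hu
    exact ⟨v, hv⟩
  have hιU : ∀ j : ι, j.1.1 ∈ U := fun j => hNU _ (Finset.mem_product.1 j.2).1
  have hιS : ∀ j : ι, j.1.2 ∈ S := fun j => hNS _ (Finset.mem_product.1 j.2).2
  let P : ι → 𝒳 × ℝ → ℝ := fun j => condDensity f j.1.1 j.1.2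
  have hPm : ∀ j, Measurable (P j) := fun j =>
    measurable_condDensity hf.measurable (hUm _ (hιU j)) (hSm _ (hιS j))
  have hιne : (Finset.univ : Finset ι).Nonempty := by
    have : Nonempty ι := (hnetU.product hnetS).to_subtype
    exact Finset.univ_nonempty
  obtain ⟨j', -, hmax, -, hmeas⟩ := exists_measurable_argmax hιne
    (ℓ := fun j (z : Fin n → 𝒳 × ℝ) => prodDensity (P j) z) fun j => measurable_prodDensity (hPm j)
  let est : (Fin n → 𝒳 × ℝ) → 𝒳 → ℝ := fun z => (j' z).1.1
  have hest : Measurable (Function.uncurry est) :=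
    hmeas (fun j : ι => j.1.1) fun j _ => hUm _ (hιU j)
  refine (iInf₂_le est hest).trans ?_
  refine iSup₂_le fun μ hμ => iSup₂_le fun σ hσ => iSup₂_le fun h hh => ?_
  have hhd := hH h hh
  have := sigmaFinite_baseMeasure hhd
  have hpos : ∀ μ ∈ U, ∀ σ ∈ S, ∀ x, 0 < σ x := fun μ hμ σ hσ x => hBpos _ (hB μ hμ σ hσ x)
  have hp : IsDensity (baseMeasure ν h) (condDensity f μ σ) :=
    isDensity_condDensity hf (hUm μ hμ) (hSm σ hσ) (hpos μ hμ σ hσ) hhd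
  have hP : ∀ j, IsDensity (baseMeasure ν h) (P j) := fun j =>
    isDensity_condDensity hf (hUm _ (hιU j)) (hSm _ (hιS j)) (hpos _ (hιU j) _ (hιS j)) hhd
  obtain ⟨u, hu, hue⟩ := hcovU μ hμ
  obtain ⟨v, hv, hve⟩ := hcovS σ hσ
  let j₀ : ι := ⟨(u, v), Finset.mem_product.2 ⟨hu, hv⟩⟩
  have hD : 0 ≤ K * (C * (2 * e ^ 2)) := by positivity
  -- The nets are close in L₂(h₀), the divergence is measured in L₂(h): the factor C makes the
  -- passage, and the 2 counts regression and scale errors.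
  have hKL : KLBound (baseMeasure ν h) (condDensity f μ σ) (P j₀) (K * (C * (2 * e ^ 2))) := by
    refine klBound_of_lintegral_klTerm_le hp.measurable (hPm j₀) ?_
    refine (lintegral_klTerm_condDensity_le hf hhd hK hKle (hUm μ hμ) (hSm σ hσ)
      (hUm _ (hιU j₀)) (hSm _ (hιS j₀)) (hB μ hμ σ hσ) (hB _ (hιU j₀) _ (hιS j₀))).trans ?_
    rw [ENNReal.ofReal_mul hK.le, ENNReal.ofReal_mul hC, two_mul,
      ENNReal.ofReal_add (sq_nonneg e) (sq_nonneg e), mul_add (ENNReal.ofReal C)]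
    gcongr
    · exact (sqDist_le_mul (hH h₀ hh₀) (hUm μ hμ) (hUm _ (hιU j₀)) (hdom h hh)).trans
        (by gcongr)
    · exact (sqDist_le_mul (hH h₀ hh₀) (hSm σ hσ) (hSm _ (hιS j₀)) (hdom h hh)).trans
        (by gcongr)
  have hhell : ∀ j, ENNReal.ofReal k * sqDist ν h μ j.1.1 ≤ ENNReal.ofReal
      (∫ z, (√(condDensity f μ σ z) - √(P j z)) ^ 2 ∂baseMeasure ν h) := by
    intro j
    rw [ofReal_integral_eq_lintegral_ofReal (integrable_hellinger hp (hP j))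
      (Eventually.of_forall fun _ => sq_nonneg _)]
    exact le_lintegral_hellinger_condDensity hf hhd hk hkle (hUm μ hμ) (hSm σ hσ)
      (hUm _ (hιU j)) (hSm _ (hιS j)) (hB μ hμ σ hσ) (hB _ (hιU j) _ (hιS j))
  have hfin : ∀ j : ι, sqDist ν h μ j.1.1 ≠ ⊤ := by
    intro j htop
    have := hhell j
    rw [htop, ENNReal.mul_top (by simpa using hk)] at this
    exact absurd this (not_le.2 ENNReal.ofReal_lt_top)
  -- One minus the affinity is half the squared Hellinger distance, hence k/2; the final factor 2/(n
  -- k) undoes n · k/2.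
  have hd : ∀ j : ι, k / 2 * (sqDist ν h μ j.1.1).toReal
      ≤ 1 - ∫ z, √(condDensity f μ σ z * P j z) ∂baseMeasure ν h := by
    intro j
    rw [integral_sqrt_mul_eq hp (hP j)]
    have h1 := ENNReal.toReal_mono ENNReal.ofReal_ne_top (hhell j)
    rw [ENNReal.toReal_mul, ENNReal.toReal_ofReal hk.le,
      ENNReal.toReal_ofReal (integral_nonneg fun _ => sq_nonneg _)] at h1
    linarith
  have hmain := lintegral_maximumLikelihood_le hp hP hD hKL (n := n) (j' := j')
    (fun z j => hmax z j (Finset.mem_univ j))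
    (d := fun j : ι => k / 2 * (sqDist ν h μ j.1.1).toReal)
    (fun j => by positivity) hd
  rw [risk, obsLaw_eq hf (hUm μ hμ) (hSm σ hσ) (hpos μ hμ σ hσ) hhd]
  have hcard : Real.log (Fintype.card ι) = Real.log NU.card + Real.log NS.card := by
    have : Fintype.card ι = NU.card * NS.card := by
      rw [Fintype.card_coe, Finset.card_product]
    rw [this, Nat.cast_mul, Real.log_mul]
    · exact_mod_cast hnetU.card_ne_zero
    · exact_mod_cast hnetS.card_ne_zero
  rw [hcard] at hmain
  have hn' : (0 : ℝ) < n := Nat.cast_pos.2 hn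
  rw [ENNReal.ofReal_mul (by positivity)]
  refine le_trans (le_of_eq ?_) (mul_le_mul_right hmain _)
  rw [← lintegral_const_mul' _ _ ENNReal.ofReal_ne_top]
  refine lintegral_congr fun z => ?_
  rw [← ENNReal.ofReal_mul (by positivity)]
  conv_lhs => rw [← ENNReal.ofReal_toReal (hfin (j' z))]
  congr 1
  field_simp

/-- A lower bound on the minimax risk from a covering set and a larger packing set. -/
theorem le_minimaxRisk_of_packing [SigmaFinite ν] (hf : IsDensity volume f)
    (hUm : ∀ μ ∈ U, Measurable μ) (hBpos : ∀ θ ∈ B, 0 < θ.2)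
    {σ : 𝒳 → ℝ} (hσ : σ ∈ S) (hσm : Measurable σ) (hB : ∀ μ ∈ U, ∀ x, (μ x, σ x) ∈ B)
    {K : ℝ} (hK : 0 < K)
    (hKle : ∀ θ ∈ B, ∀ θ' ∈ B,
      ∫⁻ y, klTerm (lsDensity f θ.1 θ.2 y) (lsDensity f θ'.1 θ'.2 y)
        ≤ ENNReal.ofReal (K * ((θ.1 - θ'.1) ^ 2 + (θ.2 - θ'.2) ^ 2)))
    {h₀ : 𝒳 → ℝ} (hh₀ : h₀ ∈ H) (hd : IsDensity ν h₀)
    {NU N : Finset (𝒳 → ℝ)} {e δ t : ℝ} (hNU : ∀ u ∈ NU, u ∈ U)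
    (hcov : ∀ u ∈ U, ∃ v ∈ NU, sqDist ν h₀ u v ≤ ENNReal.ofReal (e ^ 2))
    (hN : IsPacking ν h₀ U δ N) (hNne : N.Nonempty) (ht : 0 < t) {n : ℕ}
    (hcount : Real.exp t * NU.card + N.card * ((n * (K * e ^ 2) + 1) / t) ≤ N.card * 2⁻¹) :
    ENNReal.ofReal (δ ^ 2 / 8) ≤ minimaxRisk ν f U S H n := by
  classical
  have := sigmaFinite_baseMeasure hd
  refine le_iInf₂ fun est hest => ?_
  have hpos : ∀ μ ∈ U, ∀ x, 0 < σ x := fun μ hμ x => hBpos _ (hB μ hμ x)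
  have hp : ∀ μ ∈ U, IsDensity (baseMeasure ν h₀) (condDensity f μ σ) := fun μ hμ =>
    isDensity_condDensity hf (hUm μ hμ) hσm (hpos μ hμ) hd
  let Pn : (𝒳 → ℝ) → Measure (Fin n → 𝒳 × ℝ) := fun μ =>
    Measure.pi fun _ => densityMeasure (baseMeasure ν h₀) (condDensity f μ σ)
  have hprob : ∀ μ ∈ U, IsProbabilityMeasure (Pn μ) := fun μ hμ => by
    have := (hp μ hμ).isProbabilityMeasure
    infer_instance
  -- The event that the estimator lies within δ/2 of u; the packing property makes these events
  -- disjoint.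
  let A : (𝒳 → ℝ) → Set (Fin n → 𝒳 × ℝ) := fun u =>
    {z | sqDist ν h₀ u (est z) < ENNReal.ofReal (δ ^ 2 / 4)}
  have hsq : ∀ u ∈ U, Measurable fun z => sqDist ν h₀ u (est z) := fun u hu =>
    measurable_sqDist_est hd.measurable (hUm u hu) hest
  have hAm : ∀ u ∈ U, MeasurableSet (A u) := fun u hu =>
    measurableSet_lt (hsq u hu) measurable_const
  have hdisj : Set.PairwiseDisjoint (N : Set (𝒳 → ℝ)) A := by
    intro u hu v hv huv
    refine Set.disjoint_left.2 fun z hzu hzv => ?_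
    have h1 := hN.2 u hu v hv huv
    have hez : Measurable (est z) := hest.comp measurable_prodMk_left
    have h2 := sqDist_le_add hd (hUm u (hN.1 u hu)) (hUm v (hN.1 v hv)) hez
    have h3 : sqDist ν h₀ (est z) v < ENNReal.ofReal (δ ^ 2 / 4) := by
      rw [sqDist_comm]
      exact hzv
    have h4 : (2 : ENNReal) * (ENNReal.ofReal (δ ^ 2 / 4) + ENNReal.ofReal (δ ^ 2 / 4))
        = ENNReal.ofReal (δ ^ 2) := by
      rw [← ENNReal.ofReal_add (by positivity) (by positivity),
        show (2 : ENNReal) = ENNReal.ofReal 2 by simp, ← ENNReal.ofReal_mul zero_le_two]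
      congr 1
      ring
    have h5 : sqDist ν h₀ u (est z) ≤ ENNReal.ofReal (δ ^ 2 / 4) := le_of_lt hzu
    have h6 := h1.trans_le (h2.trans (mul_le_mul_right (add_le_add h5 h3.le) 2))
    rw [h4] at h6
    exact lt_irrefl _ h6
  have hone : ∀ v ∈ NU, ∑ u ∈ N, Pn v (A u) ≤ 1 := by
    intro v hv
    have := hprob v (hNU v hv)
    rw [← measure_biUnion_finset hdisj fun u hu => hAm u (hN.1 u hu)]
    exact prob_le_one
  set c : ENNReal := ENNReal.ofReal ((n * (K * e ^ 2) + 1) / t) with hc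
  -- Change of measure from u to a net point v near it. Passing to the sum over the whole net
  -- removes the dependence of v on u, so the sum over u can use disjointness.
  have hstep : ∀ u ∈ N, Pn u (A u) ≤ ENNReal.ofReal (Real.exp t) * ∑ v ∈ NU, Pn v (A u) + c := by
    intro u hu
    have huU := hN.1 u hu
    obtain ⟨v, hv, hve⟩ := hcov u huU
    have hvU := hNU v hv
    have hKL : KLBound (baseMeasure ν h₀) (condDensity f u σ) (condDensity f v σ) (K * e ^ 2) := by
      refine klBound_of_lintegral_klTerm_le (hp u huU).measurable (hp v hvU).measurable ?_
      refine (lintegral_klTerm_condDensity_le hf hd hK hKle (hUm u huU) hσm (hUm v hvU) hσm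
        (hB u huU) (hB v hvU)).trans ?_
      rw [sqDist_self, add_zero, ENNReal.ofReal_mul hK.le]
      gcongr
    refine (pi_le_exp_mul_add hKL (by positivity) (hp u huU) (hp v hvU) n (hAm u huU) ht).trans ?_
    gcongr
    exact Finset.single_le_sum (f := fun v => Pn v (A u)) (fun _ _ => zero_le) hv
  have hsum : ∑ u ∈ N, Pn u (A u) ≤ ∑ _u ∈ N, (2⁻¹ : ENNReal) := by
    calc ∑ u ∈ N, Pn u (A u)
        ≤ ∑ u ∈ N, (ENNReal.ofReal (Real.exp t) * ∑ v ∈ NU, Pn v (A u) + c) :=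
          Finset.sum_le_sum hstep
      _ = ENNReal.ofReal (Real.exp t) * ∑ v ∈ NU, ∑ u ∈ N, Pn v (A u) + N.card * c := by
          rw [Finset.sum_add_distrib, ← Finset.mul_sum, Finset.sum_comm, Finset.sum_const,
            nsmul_eq_mul]
      _ ≤ ENNReal.ofReal (Real.exp t) * ∑ _v ∈ NU, 1 + N.card * c := by
          gcongr with v hv
          exact hone v hv
      _ = ENNReal.ofReal (Real.exp t * NU.card + N.card * ((n * (K * e ^ 2) + 1) / t)) := by
          rw [ENNReal.ofReal_add (by positivity) (by positivity),
            ENNReal.ofReal_mul (by positivity), ENNReal.ofReal_mul (by positivity),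
            ENNReal.ofReal_natCast, ENNReal.ofReal_natCast, hc]
          simp
      _ ≤ ENNReal.ofReal (N.card * 2⁻¹) := ENNReal.ofReal_le_ofReal hcount
      _ = ∑ _u ∈ N, (2⁻¹ : ENNReal) := by
          rw [ENNReal.ofReal_mul (by positivity), ENNReal.ofReal_natCast,
            ENNReal.ofReal_inv_of_pos two_pos, Finset.sum_const, nsmul_eq_mul]
          simp
  obtain ⟨u, hu, hule⟩ : ∃ u ∈ N, Pn u (A u) ≤ 2⁻¹ := by
    by_contra! hcon
    exact absurd hsum (not_le.2 (ENNReal.sum_lt_sum_of_nonempty hNne hcon))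
  have huU := hN.1 u hu
  have := hprob u huU
  have hcompl : (2⁻¹ : ENNReal) ≤ Pn u (A u)ᶜ := by
    rw [prob_compl_eq_one_sub (hAm u huU)]
    refine le_trans (le_of_eq ?_) (tsub_le_tsub_left hule 1)
    exact ENNReal.one_sub_inv_two.symm
  have hrisk : ENNReal.ofReal (δ ^ 2 / 8) ≤ risk ν f est u σ h₀ := by
    rw [risk, obsLaw_eq hf (hUm u huU) hσm (hpos u huU) hd]
    calc ENNReal.ofReal (δ ^ 2 / 8) = ENNReal.ofReal (δ ^ 2 / 4) * 2⁻¹ := by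
          rw [show (2⁻¹ : ENNReal) = ENNReal.ofReal 2⁻¹ by
            rw [ENNReal.ofReal_inv_of_pos two_pos]; simp, ← ENNReal.ofReal_mul (by positivity)]
          congr 1
          ring
      _ ≤ ENNReal.ofReal (δ ^ 2 / 4) * Pn u (A u)ᶜ := by gcongr
      _ ≤ ENNReal.ofReal (δ ^ 2 / 4)
            * Pn u {z | ENNReal.ofReal (δ ^ 2 / 4) ≤ sqDist ν h₀ u (est z)} := by
          gcongr
          exact fun z (hz : ¬ sqDist ν h₀ u (est z) < ENNReal.ofReal (δ ^ 2 / 4)) => not_lt.1 hz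
      _ ≤ _ := mul_meas_ge_le_lintegral (hsq u huU) _
  refine hrisk.trans ?_
  exact le_iSup₂_of_le u huU (le_iSup₂_of_le σ hσ (le_iSup₂_of_le h₀ hh₀ le_rfl))

end Bounds

/-! ### Geometric growth of the entropy order -/

section Richness

variable {M : ℝ → ℝ}

theorem tendsto_const_mul_nhdsGT_zero {c : ℝ} (hc : 0 < c) :
    Tendsto (fun ε : ℝ => c * ε) (𝓝[>] 0) (𝓝[>] 0) := by
  refine tendsto_nhdsWithin_iff.2 ⟨?_, ?_⟩
  · have : Tendsto (fun ε : ℝ => c * ε) (𝓝 0) (𝓝 (c * 0)) := tendsto_const_nhds.mul tendsto_id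
    rw [mul_zero] at this
    exact this.mono_left nhdsWithin_le_nhds
  · filter_upwards [self_mem_nhdsWithin] with ε hε
    exact mul_pos hc hε

/-- Rich functions grow geometrically along geometric sequences. -/
theorem Rich.exists_geometric (hrich : Rich M) (hM0 : ∀ᶠ ε in 𝓝[>] (0 : ℝ), 0 ≤ M ε) :
    ∃ α ρ : ℝ, 0 < α ∧ α < 1 ∧ 1 < ρ ∧ (∀ᶠ ε in 𝓝[>] (0 : ℝ), 0 < M ε) ∧
      ∀ k : ℕ, ∀ᶠ ε in 𝓝[>] (0 : ℝ), ρ ^ k * M ε ≤ M (α ^ k * ε) := by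
  obtain ⟨α, hα0, hα1, hlim⟩ := hrich
  obtain ⟨ρ, hρ1, hρ⟩ := EReal.lt_iff_exists_real_btwn.1 hlim
  have hρ1' : 1 < ρ := by exact_mod_cast hρ1
  have hev := eventually_lt_of_lt_liminf hρ
  -- If M ε = 0, the ratio is 0 by the convention for division, which contradicts its eventual lower
  -- bound ρ > 1.
  have hpos : ∀ᶠ ε in 𝓝[>] (0 : ℝ), 0 < M ε := by
    filter_upwards [hev, hM0] with ε h1 h2
    refine lt_of_le_of_ne h2 fun h0 => ?_
    rw [← h0, div_zero] at h1
    have : ρ < 0 := by exact_mod_cast h1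
    linarith
  have hstep : ∀ᶠ ε in 𝓝[>] (0 : ℝ), ρ * M ε ≤ M (α * ε) := by
    filter_upwards [hev, hpos] with ε h1 h2
    have h3 : ρ < M (α * ε) / M ε := by exact_mod_cast h1
    exact ((lt_div_iff₀ h2).1 h3).le
  refine ⟨α, ρ, hα0, hα1, hρ1', hpos, fun k => ?_⟩
  induction k with
  | zero => simp
  | succ k ih =>
    filter_upwards [ih, (tendsto_const_mul_nhdsGT_zero (pow_pos hα0 k)).eventually hstep]
      with ε h1 h2
    calc ρ ^ (k + 1) * M ε = ρ * (ρ ^ k * M ε) := by ring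
      _ ≤ ρ * M (α ^ k * ε) := by gcongr
      _ ≤ M (α * (α ^ k * ε)) := h2
      _ = M (α ^ (k + 1) * ε) := by rw [pow_succ']; ring_nf

end Richness

end LocScale

/-! ### The minimax rate -/

theorem theorem1 {𝒳 : Type*} [MeasurableSpace 𝒳] (ν : Measure 𝒳) [SigmaFinite ν]
    (f : ℝ → ℝ) (hf : LocScale.IsDensity volume f)
    -- the regression functions: measurable and uniformly bounded
    (U : Set (𝒳 → ℝ)) (hUmeas : ∀ μ ∈ U, Measurable μ)
    (J : ℝ) (hUbdd : ∀ μ ∈ U, ∀ x, |μ x| ≤ J)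
    -- the scale functions: measurable and bounded away from zero and infinity
    (S : Set (𝒳 → ℝ)) (hSne : S.Nonempty) (hSmeas : ∀ σ ∈ S, Measurable σ)
    (σbar : ℝ) (hσbar : 1 < σbar) (hSbdd : ∀ σ ∈ S, ∀ x, σbar⁻¹ ≤ σ x ∧ σ x ≤ σbar)
    -- the design densities
    (H : Set (𝒳 → ℝ)) (hH : ∀ h ∈ H, LocScale.IsDensity ν h)
    -- the conditions on the error density
    (hKL : LocScale.KLFiniteContinuous f)
    (hKLlocal : LocScale.KLLocallyQuadratic f)
    (hHellinger : LocScale.HellingerNondegenerate f)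
    -- the dominating design density
    (h₀ : 𝒳 → ℝ) (hh₀ : h₀ ∈ H) (C : ℝ) (hdom : ∀ h ∈ H, ∀ x, h x ≤ C * h₀ x)
    -- the metric entropy: `M` is the order of the entropy of `U`
    (M : ℝ → ℝ) (hM : LocScale.IsEntropyOrder M (LocScale.packingEntropy ν h₀ U))
    (hrich : LocScale.Rich M) (hreg : LocScale.OrderRegular M)
    (hS : ∃ B : ℝ, ∀ᶠ ε in 𝓝[>] (0 : ℝ),
      LocScale.packingEntropy ν h₀ S ε ≤ ENNReal.ofReal (B * M ε))
    -- the solution of `M(ε_n) = n ε_n²` near zero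
    (ε : ℕ → ℝ) (hεpos : ∀ᶠ n in atTop, 0 < ε n) (hεlim : Tendsto ε atTop (𝓝 0))
    (hεeq : ∀ᶠ n : ℕ in atTop, M (ε n) = n * ε n ^ 2) :
    ∃ c₁ c₂ : ℝ, 0 < c₁ ∧ 0 < c₂ ∧ ∀ᶠ n : ℕ in atTop,
      ENNReal.ofReal (c₁ * ε n ^ 2) ≤ LocScale.minimaxRisk ν f U S H n ∧
      LocScale.minimaxRisk ν f U S H n ≤ ENNReal.ofReal (c₂ * ε n ^ 2) := by
  have hh₀d := hH h₀ hh₀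
  obtain ⟨K, hK, hKle⟩ := LocScale.exists_lintegral_klTerm_le hf hKL hKLlocal J hσbar
  obtain ⟨k, hk, hkle⟩ := LocScale.exists_le_lintegral_hellinger hf hHellinger J hσbar
  have hBpos : ∀ θ ∈ LocScale.paramBox J σbar, 0 < θ.2 := fun θ hθ =>
    LocScale.snd_pos_of_mem_paramBox hσbar hθ
  have hB : ∀ μ ∈ U, ∀ σ ∈ S, ∀ x, (μ x, σ x) ∈ LocScale.paramBox J σbar := fun μ hμ σ hσ x =>
    ⟨abs_le.1 (hUbdd μ hμ x), hSbdd σ hσ x⟩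
  obtain ⟨a, b, ha, hb, hMev⟩ := hM
  obtain ⟨B, hSev⟩ := hS
  obtain ⟨α, ρ, hα0, hα1, hρ1, hMpos, hgeom⟩ :=
    hrich.exists_geometric (hMev.mono fun _ h => h.1)
  have hpack : ∀ {r L : ℝ}, 0 ≤ L → L < a * M r →
      ENNReal.ofReal (a * M r) ≤ LocScale.packingEntropy ν h₀ U r →
      ∃ N, LocScale.IsPacking ν h₀ U r N ∧ L < Real.log N.card := fun hL hlt hle =>
    LocScale.exists_packing_of_lt hL
      (((ENNReal.ofReal_lt_ofReal_iff_of_nonneg hL).2 hlt).trans_le hle)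
  -- Richness makes M positive near zero, hence the entropy of U is positive there and some packing
  -- is nonempty.
  have hUne : U.Nonempty := by
    obtain ⟨r, h1, h2⟩ := (hMev.and hMpos).exists
    obtain ⟨N, hN, hlog⟩ := hpack le_rfl (mul_pos ha h2) h1.2.1
    have hne : N.Nonempty := by
      rw [Finset.nonempty_iff_ne_empty]
      rintro rfl
      simp at hlog
    obtain ⟨u, hu⟩ := hne
    exact ⟨u, hN.1 u hu⟩
  have hεto : Tendsto ε atTop (𝓝[>] 0) := tendsto_nhdsWithin_iff.2 ⟨hεlim, hεpos⟩
  have hlog2 : 0 < Real.log 2 := Real.log_pos one_lt_two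
  -- The packing must beat t + log |NU| + log 4 ≤ (4 K M(ε_n) + 4) + b M(ε_n) + 2. The additive 6 is
  -- absorbed through 1 ≤ (b / log 2) M(ε_n).
  obtain ⟨l, hl⟩ : ∃ l : ℕ, 4 * K + 6 * (b / Real.log 2) + b < a * ρ ^ l := by
    obtain ⟨l, hl⟩ := pow_unbounded_of_one_lt ((4 * K + 6 * (b / Real.log 2) + b) / a) hρ1
    exact ⟨l, by rwa [div_lt_iff₀' ha] at hl⟩
  have hdom' : ∀ h ∈ H, ∀ x, h x ≤ |C| * h₀ x := fun h hh x =>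
    (hdom h hh x).trans (mul_le_mul_of_nonneg_right (le_abs_self C) (hh₀d.nonneg x))
  obtain ⟨σ₀, hσ₀⟩ := hSne
  refine ⟨(α ^ l) ^ 2 / 8, 2 / k * (b + |B| + K * |C|), by positivity, by positivity, ?_⟩
  filter_upwards [eventually_gt_atTop 0, hεpos, hεeq, hεto.eventually hMev, hεto.eventually hSev,
    hεto.eventually hMpos, hεto.eventually (hgeom l),
    hεto.eventually ((LocScale.tendsto_const_mul_nhdsGT_zero (pow_pos hα0 l)).eventually hMev)]
    with n hn hεn hMn hent hentS hMnpos hgeomn hentl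
  have hn' : (0 : ℝ) < n := Nat.cast_pos.2 hn
  obtain ⟨NU, hNU, hcovU, hlogU⟩ :=
    LocScale.exists_covering (by positivity : 0 ≤ b * M (ε n)) hent.2.2
  constructor
  · obtain ⟨N₂, hN₂, hlogN₂⟩ := hpack le_rfl (mul_pos ha hMnpos) hent.2.1
    -- Positive entropy at ε_n gives a packing with at least two points, so M(ε_n) is bounded below
    -- by a constant; divergence of M is not needed.
    have htwo : Real.log 2 ≤ b * M (ε n) := by
      refine le_trans (Real.log_le_log two_pos ?_)
        (LocScale.log_card_le_of_isPacking (by positivity) hent.2.2 hN₂)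
      have : 1 < (N₂.card : ℝ) := by
        by_contra! hcon
        exact absurd (Real.log_nonpos (Nat.cast_nonneg _) hcon) (not_le.2 hlogN₂)
      have : 1 < N₂.card := by exact_mod_cast this
      exact_mod_cast this
    have hone : 1 ≤ b / Real.log 2 * M (ε n) := by
      rw [div_mul_eq_mul_div, le_div_iff₀ hlog2, one_mul]
      exact htwo
    have hlt : (4 * K + 6 * (b / Real.log 2) + b) * M (ε n) < a * M (α ^ l * ε n) := by
      calc _ < a * ρ ^ l * M (ε n) := by gcongr
        _ = a * (ρ ^ l * M (ε n)) := by ring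
        _ ≤ _ := by gcongr
    obtain ⟨N, hN, hlogN⟩ := hpack (by positivity) hlt hentl.2.1
    have hNpos : 0 < N.card := by
      rw [Nat.pos_iff_ne_zero]
      intro h0
      rw [h0, Nat.cast_zero, Real.log_zero] at hlogN
      exact absurd hlogN (not_lt.2 (by positivity))
    have hNpos' : (0 : ℝ) < N.card := Nat.cast_pos.2 hNpos
    -- Since n ε_n² = M(ε_n), this t makes the exceptional probability exactly 1/4. The packing size
    -- makes the other term at most 1/4 as well.
    have htpos : 0 < 4 * (K * M (ε n) + 1) := by positivity
    have hmain := LocScale.le_minimaxRisk_of_packing (S := S) (H := H) hf hUmeas hBpos hσ₀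
      (hSmeas σ₀ hσ₀) (fun μ hμ => hB μ hμ σ₀ hσ₀) hK hKle hh₀ hh₀d hNU hcovU hN
      (Finset.card_pos.1 hNpos) htpos (n := n) ?_
    · refine le_trans (le_of_eq ?_) hmain
      congr 1
      ring
    · have h1 : (n * (K * ε n ^ 2) + 1) / (4 * (K * M (ε n) + 1)) = 1 / 4 := by
        have e : n * (K * ε n ^ 2) + 1 = K * M (ε n) + 1 := by
          rw [hMn]
          ring
        rw [e]
        field_simp
      have h2 : Real.exp (4 * (K * M (ε n) + 1)) * NU.card ≤ N.card / 4 := by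
        rcases Nat.eq_zero_or_pos NU.card with h0 | h0
        · rw [h0, Nat.cast_zero, mul_zero]
          positivity
        · have h0' : (0 : ℝ) < NU.card := Nat.cast_pos.2 h0
          rw [← Real.log_le_log_iff (by positivity) (by positivity),
            Real.log_mul (Real.exp_pos _).ne' h0'.ne', Real.log_exp,
            Real.log_div hNpos'.ne' (by norm_num)]
          have h4 : Real.log 4 ≤ 2 := by
            rw [show (4 : ℝ) = 2 ^ 2 by norm_num, Real.log_pow]
            have := Real.log_le_sub_one_of_pos (two_pos (α := ℝ))
            push_cast
            linarith
          nlinarith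
      rw [h1]
      linarith
  · have hentS' : LocScale.packingEntropy ν h₀ S (ε n) ≤ ENNReal.ofReal (|B| * M (ε n)) :=
      hentS.trans (ENNReal.ofReal_le_ofReal
        (mul_le_mul_of_nonneg_right (le_abs_self B) hMnpos.le))
    obtain ⟨NS, hNS, hcovS, hlogS⟩ :=
      LocScale.exists_covering (by positivity : 0 ≤ |B| * M (ε n)) hentS'
    refine (LocScale.minimaxRisk_le_of_covering hf hUmeas hSmeas hH hBpos hB hK hk hKle hkle hh₀
      (abs_nonneg C) hdom' hUne ⟨σ₀, hσ₀⟩ hNU hNS hcovU hcovS hn).trans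
      (ENNReal.ofReal_le_ofReal ?_)
    calc 2 / (n * k) * (Real.log NU.card + Real.log NS.card
            + n * (K * (|C| * (2 * ε n ^ 2))) / 2)
        ≤ 2 / (n * k) * (b * M (ε n) + |B| * M (ε n)
            + n * (K * (|C| * (2 * ε n ^ 2))) / 2) := by gcongr
      _ = 2 / k * (b + |B| + K * |C|) * ε n ^ 2 := by
          rw [hMn]
          field_simp
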